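/- Let $N\ge 1$, $p>1$, $p'=p/(p-1)$, $s\in(0,1)$ with $N>ps$, $c_0>0$, $\delta>0$, and let $\Omega\subset\mathbb R^N$ be a bounded open set with extension $\Omega_\delta=\Omega\cup\bigcup_{y\in\partial\Omega}B(y,\delta)$. Let $k_\delta$ be a nonnegative radial kernel that vanishes outside $B(0,\delta)$, is integrable with $$\frac1{C_N}\int_{B(0,\delta)}k_\delta(|z|)\,dz=1,\qquad C_N=\frac{1}{\mathcal H^{N-1}(S^{N-1})}\int_{S^{N-1}}|\omega\cdot e|^p\,d\mathcal H^{N-1}(\omega)\quad(|e|=1),$$ and satisfies $k_\delta(|z|)\ge c_0|z|^{-N-(s-1)p}$ for $0<|z|<\delta$. Let $0<h_{\min}<h_{\max}$ and let $h:\Omega_\delta\to\mathbb R$ be measurable with $h\in[h_{\min},h_{\max}]$ a.e. in $\Omega$ and $h=0$ a.e. in $\Omega_\delta\setminus\Omega$. Put $H(x',x)=\frac{h(x')+h(x)}2$, $$B_h(u,v)=\int_{\Omega_\delta}\int_{\Omega_\delta}H(x',x)\,k_\delta(|x'-x|)\,\frac{|u(x')-u(x)|^{p-2}(u(x')-u(x))}{|x'-x|^p}\,(v(x')-v(x))\,dx'\,dx,$$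 and let $B(u,v)$ be the same integral with $H$ replaced by $1$. Let $$X=\{u\in L^p(\Omega_\delta):B(u,u)<\infty\},\quad \|u\|_X=\|u\|_{L^p(\Omega_\delta)}+B(u,u)^{1/p},\quad X_0=\{u\in X:u=0\text{ a.e. in }\Omega_\delta\setminus\Omega\},$$ and let $u_0$ be a function on $\Omega_\delta\setminus\Omega$ that is the restriction of an element of $X$. A state associated with $g\in L^{p'}(\Omega)$ is a function $u\in X$ with $u=u_0$ a.e. in $\Omega_\delta\setminus\Omega$ and $B_h(u,w)=\int_\Omega g\,w\,dx$ for all $w\in X_0$. Let $(g_j)$ be a bounded sequence in $L^{p'}(\Omega)$ that converges weakly in $L^{p'}(\Omega)$ to $g$, let $u_j$ be the state associated with $g_j$, and let $u$ be the state associated with $g$. Then $$\lim_{j\to\infty}B_h(u_j,u_j)=B_h(u,u),\qquad \lim_{j\to\infty}B_h(u_j-u,u_j-u)=0,$$ and $u_j\to u$ strongly in $X$, i.e. $\lim_{j\to\infty}\|u_j-u\|_X=0$. -/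

import Mathlib

open MeasureTheory Filter Topology Metric Set

noncomputable section

namespace NonlocalPLaplace

/-- The extension `Ω_δ = Ω ∪ ⋃_{y ∈ ∂Ω} B(y, δ)` of a set `Ω ⊆ ℝ^N`. -/
def extendedDomain {N : ℕ} (Ω : Set (EuclideanSpace ℝ (Fin N))) (δ : ℝ) :
    Set (EuclideanSpace ℝ (Fin N)) :=
  Ω ∪ ⋃ y ∈ frontier Ω, ball y δ

/-- The constant `C_N`: the mean of `|ω · e| ^ p` over the unit sphere with respect to the
`(N - 1)`-dimensional Hausdorff measure. Its value does not depend on the unit vector `e`. -/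
def sphereMean {N : ℕ} (p : ℝ) (e : EuclideanSpace ℝ (Fin N)) : ℝ :=
  (1 / (Measure.hausdorffMeasure ((N : ℝ) - 1)).real
      (sphere (0 : EuclideanSpace ℝ (Fin N)) 1)) *
    ∫ ω in sphere (0 : EuclideanSpace ℝ (Fin N)) 1, |inner ℝ ω e| ^ p
      ∂(Measure.hausdorffMeasure ((N : ℝ) - 1))

/-- The hypotheses on the kernel with horizon `δ`; `k` is the radial profile, so that the kernel
on `ℝ^N` is `z ↦ k ‖z‖`. -/
structure IsHorizonKernel {N : ℕ} (p s c₀ δ : ℝ) (e : EuclideanSpace ℝ (Fin N))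
    (k : ℝ → ℝ) : Prop where
  nonneg : ∀ r, 0 ≤ r → 0 ≤ k r
  support : ∀ r, δ ≤ r → k r = 0
  integrable : IntegrableOn (fun z : EuclideanSpace ℝ (Fin N) => k ‖z‖) (ball 0 δ)
  normalized :
    (1 / sphereMean p e) * ∫ z in ball (0 : EuclideanSpace ℝ (Fin N)) δ, k ‖z‖ = 1
  lower_bound : ∀ z : EuclideanSpace ℝ (Fin N), 0 < ‖z‖ → ‖z‖ < δ →
    c₀ / ‖z‖ ^ ((N : ℝ) + (s - 1) * p) ≤ k ‖z‖

/-- The class of diffusion coefficients on `Ω_δ`: measurable, with values in `[hmin, hmax]`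
almost everywhere in `Ω`, and zero in `Ω_δ \ Ω`. -/
structure IsDiffusionCoefficient {N : ℕ} (Ω : Set (EuclideanSpace ℝ (Fin N)))
    (δ hmin hmax : ℝ) (h : EuclideanSpace ℝ (Fin N) → ℝ) : Prop where
  aemeasurable : AEMeasurable h (volume.restrict (extendedDomain Ω δ))
  mem_Icc : ∀ᵐ x ∂(volume.restrict Ω), h x ∈ Icc hmin hmax
  eq_zero : ∀ᵐ x ∂(volume.restrict (extendedDomain Ω δ \ Ω)), h x = 0

/-- The integrand
`k(|x' - x|) |u(x') - u(x)|^(p-2) (u(x') - u(x)) / |x' - x|^p * (v(x') - v(x))`,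
at the point `z = (x', x)`. -/
def formIntegrand {N : ℕ} (p : ℝ) (k : ℝ → ℝ) (u v : EuclideanSpace ℝ (Fin N) → ℝ)
    (z : EuclideanSpace ℝ (Fin N) × EuclideanSpace ℝ (Fin N)) : ℝ :=
  k ‖z.1 - z.2‖ *
    (|u z.1 - u z.2| ^ (p - 2) * (u z.1 - u z.2) / ‖z.1 - z.2‖ ^ p) * (v z.1 - v z.2)

/-- The form `B(u, v)`, a double integral over `Ω_δ × Ω_δ`. -/
def B {N : ℕ} (Ω : Set (EuclideanSpace ℝ (Fin N))) (p δ : ℝ) (k : ℝ → ℝ)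
    (u v : EuclideanSpace ℝ (Fin N) → ℝ) : ℝ :=
  ∫ z in extendedDomain Ω δ ×ˢ extendedDomain Ω δ, formIntegrand p k u v z

/-- The form `B_h(u, v)`, where the integrand has the additional factor
`H(x', x) = (h(x') + h(x)) / 2`. -/
def Bh {N : ℕ} (Ω : Set (EuclideanSpace ℝ (Fin N))) (p δ : ℝ) (k : ℝ → ℝ)
    (h u v : EuclideanSpace ℝ (Fin N) → ℝ) : ℝ :=
  ∫ z in extendedDomain Ω δ ×ˢ extendedDomain Ω δ,
    ((h z.1 + h z.2) / 2) * formIntegrand p k u v z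

/-- The nonlocal energy space `X = {u ∈ L^p(Ω_δ) : B(u, u) < ∞}`. The integrand of `B(u, u)` is
nonnegative, so finiteness of the integral means integrability. -/
def X {N : ℕ} (Ω : Set (EuclideanSpace ℝ (Fin N))) (p δ : ℝ) (k : ℝ → ℝ) :
    Set (EuclideanSpace ℝ (Fin N) → ℝ) :=
  {u | MemLp u (ENNReal.ofReal p) (volume.restrict (extendedDomain Ω δ)) ∧
    IntegrableOn (formIntegrand p k u u) (extendedDomain Ω δ ×ˢ extendedDomain Ω δ)}

/-- The constrained space `X₀ = {u ∈ X : u = 0 in Ω_δ \ Ω}`. -/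
def X₀ {N : ℕ} (Ω : Set (EuclideanSpace ℝ (Fin N))) (p δ : ℝ) (k : ℝ → ℝ) :
    Set (EuclideanSpace ℝ (Fin N) → ℝ) :=
  {u | u ∈ X Ω p δ k ∧ ∀ᵐ x ∂(volume.restrict (extendedDomain Ω δ \ Ω)), u x = 0}

/-- The norm `‖u‖_X = ‖u‖_{L^p(Ω_δ)} + B(u, u)^(1/p)` of an element of `X`. -/
def normX {N : ℕ} (Ω : Set (EuclideanSpace ℝ (Fin N))) (p δ : ℝ) (k : ℝ → ℝ)
    (u : EuclideanSpace ℝ (Fin N) → ℝ) : ℝ :=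
  (eLpNorm u (ENNReal.ofReal p) (volume.restrict (extendedDomain Ω δ))).toReal +
    B Ω p δ k u u ^ (1 / p)

/-- `u₀` is an admissible boundary datum: on `Ω_δ \ Ω` it is the restriction of a function
from `X`. -/
def IsBoundaryDatum {N : ℕ} (Ω : Set (EuclideanSpace ℝ (Fin N))) (p δ : ℝ) (k : ℝ → ℝ)
    (u₀ : EuclideanSpace ℝ (Fin N) → ℝ) : Prop :=
  ∃ w ∈ X Ω p δ k, ∀ᵐ x ∂(volume.restrict (extendedDomain Ω δ \ Ω)), w x = u₀ x

/-- `u` is the state associated with the source `g`: `u ∈ X`, `u = u₀` in `Ω_δ \ Ω`, and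
`B_h(u, w) = ∫_Ω g w` for every `w ∈ X₀`. -/
structure IsState {N : ℕ} (Ω : Set (EuclideanSpace ℝ (Fin N))) (p δ : ℝ) (k : ℝ → ℝ)
    (h u₀ g u : EuclideanSpace ℝ (Fin N) → ℝ) : Prop where
  mem_X : u ∈ X Ω p δ k
  boundary : ∀ᵐ x ∂(volume.restrict (extendedDomain Ω δ \ Ω)), u x = u₀ x
  equation : ∀ w ∈ X₀ Ω p δ k, Bh Ω p δ k h u w = ∫ x in Ω, g x * w x

/-- Weak convergence in `L^q(Ω)`, `1 < q < ∞`, tested against the dual space `L^r(Ω)`,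
`1/q + 1/r = 1`. -/
def WeaklyConverges {N : ℕ} (Ω : Set (EuclideanSpace ℝ (Fin N))) (r : ℝ)
    (g : ℕ → EuclideanSpace ℝ (Fin N) → ℝ) (g' : EuclideanSpace ℝ (Fin N) → ℝ) : Prop :=
  ∀ φ : EuclideanSpace ℝ (Fin N) → ℝ, MemLp φ (ENNReal.ofReal r) (volume.restrict Ω) →
    Tendsto (fun j => ∫ x in Ω, g j x * φ x) atTop (𝓝 (∫ x in Ω, g' x * φ x))

end NonlocalPLaplace

end

/-! Put `w = u_j - u`, which lies in `X₀`. Subtracting the two state equations tested with `w` gives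
`B_h(u_j, w) - B_h(u, w) = ∫ (g_j - g) w`, so it remains to extract norm and energy convergence from
the left side and smallness from the right side.

Left side: `φ(a) = |a|^(p-2) a` is strictly increasing and homogeneous, and compactness yields for
every `p > 1` `|a-b|^p + ||a|^p - |b|^p| ≤ ε |b|^p + C_ε (φ(a) - φ(b)) (a-b)`
(`exists_le_rpow_add_monotone_product`). Integration against the weighted kernel bounds `B_h(w,w) +
|B_h(u_j,u_j) - B_h(u,u)|` by `ε B_h(u,u) + C_ε ∫ (g_j - g) w` (`exists_Bh_sub_le`), with no need to
distinguish `p < 2` from `p ≥ 2`.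

Right side: weak convergence is uniform on energy-bounded sets, in the form `|∫ (g_j - g) w| ≤ η (1
+ B(w,w))` for large `j` and all `w ∈ X₀` (`eventually_abs_integral_sub_mul_le`). This replaces a
compact embedding: averaging over balls of radius `ρ` costs only a small amount of energy, by the
lower bound on the kernel, and for fixed `ρ` the averages of `g_j - g` converge strongly.

On `X₀` the degenerate coefficient is harmless: `B(w,w) ≤ (2/hmin) B_h(w,w)` (`B_le_Bh_of_mem_X₀`),
so the energy on the right is absorbed. The Poincaré inequality `exists_poincare` then controls the
`L^p` part of the norm. -/

namespace NonlocalPLaplace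

/-! ### Scalar inequalities for the monotone power -/

/-- For `p < 2` the factor `|a|^(p-2)` is singular at zero. Splitting into positive and negative
parts leaves only the positive exponent `p - 1`, from which continuity and strict monotonicity can
be read off. -/
lemma abs_rpow_sub_two_mul_eq {p : ℝ} (hp : 1 < p) (a : ℝ) :
    |a| ^ (p - 2) * a = max a 0 ^ (p - 1) - max (-a) 0 ^ (p - 1) := by
  have h0 : (0 : ℝ) ^ (p - 1) = 0 := Real.zero_rpow (by linarith)
  have hpos : ∀ x : ℝ, 0 < x → x ^ (p - 2) * x = x ^ (p - 1) := fun x hx => by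
    rw [← Real.rpow_add_one hx.ne']; ring_nf
  rcases lt_trichotomy a 0 with ha | rfl | ha
  · rw [abs_of_neg ha, max_eq_right ha.le, max_eq_left (by linarith : (0 : ℝ) ≤ -a), h0,
      ← hpos (-a) (by linarith)]
    ring
  · simp
  · rw [abs_of_pos ha, max_eq_left ha.le, max_eq_right (by linarith : -a ≤ (0 : ℝ)), h0,
      ← hpos a ha]
    ring

lemma continuous_abs_rpow_sub_two_mul {p : ℝ} (hp : 1 < p) :
    Continuous fun a : ℝ => |a| ^ (p - 2) * a := by
  simp_rw [abs_rpow_sub_two_mul_eq hp]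
  have hp' : 0 ≤ p - 1 := by linarith
  exact ((continuous_id.max continuous_const).rpow_const fun _ => Or.inr hp').sub
    ((continuous_neg.max continuous_const).rpow_const fun _ => Or.inr hp')

lemma strictMono_abs_rpow_sub_two_mul {p : ℝ} (hp : 1 < p) :
    StrictMono fun a : ℝ => |a| ^ (p - 2) * a := by
  intro a b hab
  simp only [abs_rpow_sub_two_mul_eq hp]
  have hp' : 0 < p - 1 := by linarith
  have h1 : max a 0 ^ (p - 1) ≤ max b 0 ^ (p - 1) :=
    Real.rpow_le_rpow (le_max_right _ _) (max_le_max hab.le le_rfl) hp'.le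
  have h2 : max (-b) 0 ^ (p - 1) ≤ max (-a) 0 ^ (p - 1) :=
    Real.rpow_le_rpow (le_max_right _ _) (max_le_max (by linarith) le_rfl) hp'.le
  rcases lt_or_ge 0 b with hb | hb
  · have : max a 0 ^ (p - 1) < max b 0 ^ (p - 1) :=
      Real.rpow_lt_rpow (le_max_right _ _) (by simp [hb, hab]) hp'
    linarith
  · have : max (-b) 0 ^ (p - 1) < max (-a) 0 ^ (p - 1) :=
      Real.rpow_lt_rpow (le_max_right _ _)
        (by rw [max_eq_left (by linarith), max_eq_left (by linarith)]; linarith) hp'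
    linarith

lemma abs_rpow_sub_two_mul_self {p : ℝ} (hp : 1 < p) (a : ℝ) :
    |a| ^ (p - 2) * a * a = |a| ^ p := by
  rcases eq_or_ne a 0 with rfl | ha
  · simp [Real.zero_rpow (by linarith : p ≠ 0)]
  · have := Real.rpow_add_natCast (abs_ne_zero.2 ha) (p - 2) 2
    rw [mul_assoc, ← pow_two, ← sq_abs, ← this]
    norm_num

lemma abs_rpow_sub_two_mul_abs {p : ℝ} (hp : 1 < p) (a : ℝ) :
    |(|a| ^ (p - 2) * a)| = |a| ^ (p - 1) := by
  rcases eq_or_ne a 0 with rfl | ha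
  · simp [Real.zero_rpow (by linarith : p - 1 ≠ 0)]
  · rw [abs_mul, abs_of_nonneg (by positivity : 0 ≤ |a| ^ (p - 2)),
      ← Real.rpow_add_one (abs_ne_zero.2 ha)]
    ring_nf

lemma monotone_product_nonneg {p : ℝ} (hp : 1 < p) (a b : ℝ) :
    0 ≤ (|a| ^ (p - 2) * a - |b| ^ (p - 2) * b) * (a - b) := by
  have hm := (strictMono_abs_rpow_sub_two_mul hp).monotone
  rcases le_total a b with hab | hab
  · exact mul_nonneg_of_nonpos_of_nonpos (by have := hm hab; simp only at this; linarith)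
      (by linarith)
  · exact mul_nonneg (by have := hm hab; simp only at this; linarith) (by linarith)

lemma abs_rpow_sub_two_mul_smul {p : ℝ} {t : ℝ} (ht : 0 < t) (a : ℝ) :
    |t * a| ^ (p - 2) * (t * a) = t ^ (p - 1) * (|a| ^ (p - 2) * a) := by
  rw [abs_mul, abs_of_pos ht, Real.mul_rpow ht.le (abs_nonneg a),
    show p - 1 = (p - 2) + 1 by ring, Real.rpow_add_one ht.ne']
  ring

/-- A quantitative form of strict monotonicity of `a ↦ |a| ^ (p - 2) * a`, valid for every
`p > 1`, up to an arbitrarily small multiple of `|a| ^ p + |b| ^ p`. -/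
lemma exists_le_add_monotone_product {p : ℝ} (hp : 1 < p) {ε : ℝ} (hε : 0 < ε) :
    ∃ C : ℝ, 0 ≤ C ∧ ∀ a b : ℝ, |a - b| ^ p + |(|a| ^ p - |b| ^ p)| ≤
      ε * (|a| ^ p + |b| ^ p) +
        C * ((|a| ^ (p - 2) * a - |b| ^ (p - 2) * b) * (a - b)) := by
  have hp0 : 0 < p := by linarith
  have cpow : Continuous fun a : ℝ => |a| ^ p :=
    continuous_abs.rpow_const fun _ => Or.inr hp0.le
  have cφ := continuous_abs_rpow_sub_two_mul hp
  set f : ℝ × ℝ → ℝ := fun x => |x.1 - x.2| ^ p + |(|x.1| ^ p - |x.2| ^ p)| with hf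
  set m : ℝ × ℝ → ℝ :=
    fun x => (|x.1| ^ (p - 2) * x.1 - |x.2| ^ (p - 2) * x.2) * (x.1 - x.2) with hm
  have cf : Continuous f :=
    (cpow.comp (continuous_fst.sub continuous_snd)).add
      ((cpow.comp continuous_fst).sub (cpow.comp continuous_snd)).abs
  have cm : Continuous m :=
    ((cφ.comp continuous_fst).sub (cφ.comp continuous_snd)).mul
      (continuous_fst.sub continuous_snd)
  have cs : Continuous fun x : ℝ × ℝ => |x.1| ^ p + |x.2| ^ p :=
    (cpow.comp continuous_fst).add (cpow.comp continuous_snd)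
  -- By homogeneity it suffices to treat `|a|^p + |b|^p = 1`. On `K`, the compact part of this level
  -- set where `f ≥ ε`, the product `m` has a positive minimum: `m = 0` forces `a = b`, hence `f = 0
  -- < ε`.
  set K : Set (ℝ × ℝ) := {x | |x.1| ^ p + |x.2| ^ p = 1 ∧ ε ≤ f x} with hK
  have hle1 : ∀ a b : ℝ, |a| ^ p + |b| ^ p = 1 → |a| ≤ 1 := fun a b h => by
    by_contra! hc
    have := Real.one_lt_rpow hc hp0
    have : 0 ≤ |b| ^ p := by positivity
    linarith
  have hKc : IsCompact K := by
    refine Metric.isCompact_of_isClosed_isBounded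
      ((isClosed_eq cs continuous_const).inter (isClosed_le continuous_const cf))
      ((Metric.isBounded_closedBall (x := (0 : ℝ × ℝ)) (r := 1)).subset ?_)
    rintro ⟨a, b⟩ ⟨h1, -⟩
    simp only [mem_closedBall_zero_iff, Prod.norm_def, Real.norm_eq_abs, max_le_iff]
    exact ⟨hle1 a b h1, hle1 b a (by rw [add_comm]; exact h1)⟩
  have hm0 : ∀ x, 0 ≤ m x := fun x => monotone_product_nonneg hp _ _
  obtain ⟨C, hC0, hC⟩ : ∃ C : ℝ, 0 ≤ C ∧ ∀ x ∈ K, f x ≤ C * m x := by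
    rcases K.eq_empty_or_nonempty with hemp | hne
    · exact ⟨0, le_rfl, by simp [hemp]⟩
    obtain ⟨x₀, hx₀, hmin⟩ := hKc.exists_isMinOn hne cm.continuousOn
    obtain ⟨x₁, hx₁, hmax⟩ := hKc.exists_isMaxOn hne cf.continuousOn
    have hpos : 0 < m x₀ := by
      refine lt_of_le_of_ne (hm0 _) fun h0 => ?_
      have heq : x₀.1 = x₀.2 := by
        rcases mul_eq_zero.1 h0.symm with h | h
        · exact (strictMono_abs_rpow_sub_two_mul hp).injective (sub_eq_zero.1 h)
        · exact sub_eq_zero.1 h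
      have : f x₀ = 0 := by simp [hf, heq, Real.zero_rpow hp0.ne']
      have := hx₀.2
      linarith
    have hf1 : 0 ≤ f x₁ := hε.le.trans hx₁.2
    refine ⟨f x₁ / m x₀, by positivity, fun x hx => ?_⟩
    calc f x ≤ f x₁ := hmax hx
      _ = f x₁ / m x₀ * m x₀ := by field_simp
      _ ≤ f x₁ / m x₀ * m x := by gcongr; exact hmin hx
  refine ⟨C, hC0, fun a b => ?_⟩
  obtain ⟨t, ht⟩ : ∃ t, t = |a| ^ p + |b| ^ p := ⟨_, rfl⟩
  have ht0 : 0 ≤ t := by rw [ht]; positivity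
  rcases ht0.eq_or_lt with h0 | htpos
  · have ha : |a| ^ p = 0 := by
      have : 0 ≤ |a| ^ p := by positivity
      have : 0 ≤ |b| ^ p := by positivity
      linarith
    have hb : |b| ^ p = 0 := by linarith
    rw [Real.rpow_eq_zero (abs_nonneg _) hp0.ne', abs_eq_zero] at ha hb
    simp [ha, hb, Real.zero_rpow hp0.ne']
  -- Dividing by `l = t^(1/p)` moves the pair to the normalised level set; `f` and `m` both scale by
  -- `l^p = t`.
  obtain ⟨l, hlpos, hlp⟩ : ∃ l : ℝ, 0 < l ∧ l ^ p = t :=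
    ⟨t ^ (1 / p), by positivity, by
      rw [← Real.rpow_mul ht0, one_div_mul_cancel hp0.ne', Real.rpow_one]⟩
  obtain ⟨a', rfl⟩ : ∃ a', a = l * a' := ⟨a / l, by field_simp⟩
  obtain ⟨b', rfl⟩ : ∃ b', b = l * b' := ⟨b / l, by field_simp⟩
  have hpw : ∀ c : ℝ, |l * c| ^ p = t * |c| ^ p := fun c => by
    rw [abs_mul, abs_of_pos hlpos, Real.mul_rpow hlpos.le (abs_nonneg c), hlp]
  have hnorm : |a'| ^ p + |b'| ^ p = 1 := by
    rw [hpw, hpw, ← mul_add] at ht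
    exact mul_left_cancel₀ htpos.ne' (by linarith)
  -- Off `K` the term `ε` alone suffices, because `m ≥ 0`.
  have hlast : f (a', b') ≤ ε + C * m (a', b') := by
    by_cases hmem : ε ≤ f (a', b')
    · have := hC _ (show (a', b') ∈ K from ⟨hnorm, hmem⟩); linarith
    · have := mul_nonneg hC0 (hm0 (a', b')); linarith [not_le.1 hmem]
  have e1 : |l * a' - l * b'| ^ p + |(|l * a'| ^ p - |l * b'| ^ p)| = t * f (a', b') := by
    rw [← mul_sub, hpw, hpw, hpw, ← mul_sub, abs_mul t, abs_of_pos htpos, ← mul_add]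
  have e2 : (|l * a'| ^ (p - 2) * (l * a') - |l * b'| ^ (p - 2) * (l * b')) * (l * a' - l * b')
      = t * m (a', b') := by
    have : l ^ (p - 1) * l = t := by
      rw [← Real.rpow_add_one hlpos.ne', ← hlp]; ring_nf
    rw [abs_rpow_sub_two_mul_smul hlpos, abs_rpow_sub_two_mul_smul hlpos, hm, ← this]
    ring
  rw [e1, e2]
  calc t * f (a', b') ≤ t * (ε + C * m (a', b')) := by gcongr
    _ = _ := by rw [← ht]; ring

/-- Since `|a|^p ≤ ||a|^p - |b|^p| + |b|^p`, the power of `a` on the right can be absorbed on the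
left once its factor is at most `1/2`. Only the fixed reference `b` remains, so no a priori bound on
the energies of the varying states is needed. -/
lemma exists_le_rpow_add_monotone_product {p : ℝ} (hp : 1 < p) {ε : ℝ} (hε : 0 < ε) :
    ∃ C : ℝ, 0 ≤ C ∧ ∀ a b : ℝ, |a - b| ^ p + |(|a| ^ p - |b| ^ p)| ≤
      ε * |b| ^ p + C * ((|a| ^ (p - 2) * a - |b| ^ (p - 2) * b) * (a - b)) := by
  set η := min (1 / 2) (ε / 4) with hη
  have hη0 : 0 < η := lt_min (by norm_num) (by linarith)
  have hη1 : η ≤ 1 / 2 := min_le_left _ _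
  have hη2 : η ≤ ε / 4 := min_le_right _ _
  obtain ⟨C, hC0, hC⟩ := exists_le_add_monotone_product hp hη0
  refine ⟨2 * C, by positivity, fun a b => ?_⟩
  have h1 := hC a b
  have h2 := le_abs_self (|a| ^ p - |b| ^ p)
  have h3 : 0 ≤ |a - b| ^ p := by positivity
  have h4 : 0 ≤ |b| ^ p := by positivity
  set M := (|a| ^ (p - 2) * a - |b| ^ (p - 2) * b) * (a - b)
  set f := |a - b| ^ p + |(|a| ^ p - |b| ^ p)| with hf
  have h5 : |a| ^ p + |b| ^ p ≤ f + 2 * |b| ^ p := by linarith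
  have hf0 : 0 ≤ f := by positivity
  have h6 : η * (|a| ^ p + |b| ^ p) ≤ η * (f + 2 * |b| ^ p) := by gcongr
  have h7 : η * f ≤ 1 / 2 * f := by gcongr
  have h8 : η * |b| ^ p ≤ ε / 4 * |b| ^ p := by gcongr
  linarith

lemma abs_sub_rpow_le {p : ℝ} (hp : 1 < p) (a b : ℝ) :
    |a - b| ^ p ≤ 2 ^ p * (|a| ^ p + |b| ^ p) := by
  have hp0 : 0 ≤ p := by linarith
  have h : |a - b| ≤ 2 * max |a| |b| := by
    have := abs_sub a b
    have := le_max_left |a| |b|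
    have := le_max_right |a| |b|
    linarith
  calc |a - b| ^ p ≤ (2 * max |a| |b|) ^ p := by gcongr
    _ = 2 ^ p * max |a| |b| ^ p := Real.mul_rpow (by norm_num) (by positivity)
    _ ≤ 2 ^ p * (|a| ^ p + |b| ^ p) := by
      gcongr
      have : 0 ≤ |a| ^ p := by positivity
      have : 0 ≤ |b| ^ p := by positivity
      rcases max_choice |a| |b| with h | h <;> rw [h] <;> linarith

lemma rpow_sub_one_mul_le {p : ℝ} (hp : 1 < p) {a b : ℝ} (ha : 0 ≤ a) (hb : 0 ≤ b) :
    a ^ (p - 1) * b ≤ a ^ p + b ^ p := by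
  have key : ∀ c : ℝ, 0 ≤ c → c ^ (p - 1) * c = c ^ p := fun c hc => by
    rcases hc.eq_or_lt with rfl | hc
    · simp [Real.zero_rpow (by linarith : p ≠ 0)]
    · rw [← Real.rpow_add_one hc.ne']; ring_nf
  have hp' : 0 ≤ p - 1 := by linarith
  have h1 : 0 ≤ a ^ p := by positivity
  have h2 : 0 ≤ b ^ p := by positivity
  rcases le_total a b with hab | hab
  · calc a ^ (p - 1) * b ≤ b ^ (p - 1) * b := by gcongr
      _ ≤ _ := by rw [key b hb]; linarith
  · calc a ^ (p - 1) * b ≤ a ^ (p - 1) * a := by gcongr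
      _ ≤ _ := by rw [key a ha]; linarith

/-- Young's inequality with an arbitrarily small factor on the `p`-th power. -/
lemma exists_mul_le_rpow {p q : ℝ} (hpq : p.HolderConjugate q) {ε : ℝ} (hε : 0 < ε) :
    ∃ C : ℝ, 0 ≤ C ∧ ∀ a b : ℝ, |a * b| ≤ ε * |a| ^ p + C * |b| ^ q := by
  have hp0 := hpq.pos
  have hq0 := hpq.symm.pos
  set t := ε ^ (1 / p) with ht
  have htpos : 0 < t := by positivity
  have htp : t ^ p = ε := by
    rw [ht, ← Real.rpow_mul hε.le, one_div_mul_cancel hp0.ne', Real.rpow_one]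
  -- Young's inequality for `t|a|` and `|b|/t` with `t^p = ε`; the factors `1/p` and `1/q` are
  -- discarded.
  refine ⟨(1 / t) ^ q, by positivity, fun a b => ?_⟩
  have h := Real.young_inequality_of_nonneg (a := t * |a|) (b := 1 / t * |b|) (by positivity)
    (by positivity) hpq
  rw [Real.mul_rpow htpos.le (abs_nonneg _), Real.mul_rpow (by positivity) (abs_nonneg _),
    htp] at h
  have h1 : ε * |a| ^ p / p ≤ ε * |a| ^ p := div_le_self (by positivity) hpq.lt.le
  have h2 : (1 / t) ^ q * |b| ^ q / q ≤ (1 / t) ^ q * |b| ^ q :=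
    div_le_self (by positivity) hpq.symm.lt.le
  have h3 : t * |a| * (1 / t * |b|) = |a * b| := by rw [abs_mul]; field_simp
  linarith

/-! ### The forms `B` and `B_h`: integrability, monotonicity, coercivity -/

section Forms

variable {N : ℕ} {Ω : Set (EuclideanSpace ℝ (Fin N))} {p s c₀ δ hmin hmax : ℝ}
  {e : EuclideanSpace ℝ (Fin N)} {k : ℝ → ℝ} {h u v w : EuclideanSpace ℝ (Fin N) → ℝ}

/-- The weight `k(|x' - x|) / |x' - x| ^ p` at `z = (x', x)`. -/
noncomputable def kernelWeight (p : ℝ) (k : ℝ → ℝ)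
    (z : EuclideanSpace ℝ (Fin N) × EuclideanSpace ℝ (Fin N)) : ℝ :=
  k ‖z.1 - z.2‖ / ‖z.1 - z.2‖ ^ p

lemma formIntegrand_eq (u v : EuclideanSpace ℝ (Fin N) → ℝ)
    (z : EuclideanSpace ℝ (Fin N) × EuclideanSpace ℝ (Fin N)) :
    formIntegrand p k u v z = kernelWeight p k z *
      (|u z.1 - u z.2| ^ (p - 2) * (u z.1 - u z.2) * (v z.1 - v z.2)) := by
  simp only [formIntegrand, kernelWeight]; ring

lemma formIntegrand_self (hp : 1 < p) (u : EuclideanSpace ℝ (Fin N) → ℝ)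
    (z : EuclideanSpace ℝ (Fin N) × EuclideanSpace ℝ (Fin N)) :
    formIntegrand p k u u z = kernelWeight p k z * |u z.1 - u z.2| ^ p := by
  rw [formIntegrand_eq, abs_rpow_sub_two_mul_self hp]

lemma kernelWeight_nonneg (hk : IsHorizonKernel p s c₀ δ e k)
    (z : EuclideanSpace ℝ (Fin N) × EuclideanSpace ℝ (Fin N)) : 0 ≤ kernelWeight p k z :=
  div_nonneg (hk.nonneg _ (norm_nonneg _)) (by positivity)

lemma isOpen_extendedDomain (hΩ : IsOpen Ω) : IsOpen (extendedDomain Ω δ) :=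
  hΩ.union (isOpen_biUnion fun _ _ => isOpen_ball)

lemma subset_extendedDomain : Ω ⊆ extendedDomain Ω δ := subset_union_left

lemma ae_restrict_prod_self {S : Set (EuclideanSpace ℝ (Fin N))}
    {P : EuclideanSpace ℝ (Fin N) → Prop} (hP : ∀ᵐ x ∂(volume.restrict S), P x) :
    ∀ᵐ z ∂((volume : Measure (EuclideanSpace ℝ (Fin N) × EuclideanSpace ℝ (Fin N))).restrict
      (S ×ˢ S)), P z.1 ∧ P z.2 := by
  rw [Measure.volume_eq_prod, ← Measure.prod_restrict]
  exact (Measure.quasiMeasurePreserving_fst.ae hP).and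
    (Measure.quasiMeasurePreserving_snd.ae hP)

lemma aestronglyMeasurable_fst_restrict {S : Set (EuclideanSpace ℝ (Fin N))}
    (hu : AEStronglyMeasurable u (volume.restrict S)) :
    AEStronglyMeasurable (fun z : EuclideanSpace ℝ (Fin N) × EuclideanSpace ℝ (Fin N) => u z.1)
      (volume.restrict (S ×ˢ S)) := by
  rw [Measure.volume_eq_prod, ← Measure.prod_restrict]
  exact hu.comp_fst

lemma aestronglyMeasurable_snd_restrict {S : Set (EuclideanSpace ℝ (Fin N))}
    (hu : AEStronglyMeasurable u (volume.restrict S)) :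
    AEStronglyMeasurable (fun z : EuclideanSpace ℝ (Fin N) × EuclideanSpace ℝ (Fin N) => u z.2)
      (volume.restrict (S ×ˢ S)) := by
  rw [Measure.volume_eq_prod, ← Measure.prod_restrict]
  exact hu.comp_snd

/-- The profile `k` is not assumed measurable. Integrability on the ball and vanishing outside it
make `z ↦ k ‖z‖` a.e. strongly measurable, and subtraction, being quasi measure preserving, pulls
this back to pairs. -/
lemma aestronglyMeasurable_kernelWeight (hk : IsHorizonKernel p s c₀ δ e k) :
    AEStronglyMeasurable (kernelWeight (N := N) p k) volume := by
  have h1 : AEStronglyMeasurable (fun z : EuclideanSpace ℝ (Fin N) => k ‖z‖) volume := by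
    have := hk.integrable.aestronglyMeasurable
    rw [← aestronglyMeasurable_indicator_iff measurableSet_ball] at this
    rwa [indicator_eq_self.2] at this
    intro z hz
    by_contra hz'
    exact hz (hk.support _ (by simpa using hz'))
  have h2 : AEStronglyMeasurable
      (fun z : EuclideanSpace ℝ (Fin N) × EuclideanSpace ℝ (Fin N) => k ‖z.1 - z.2‖) volume :=
    h1.comp_quasiMeasurePreserving
      (quasiMeasurePreserving_sub_of_right_invariant (volume : Measure (EuclideanSpace ℝ (Fin N)))
        (volume : Measure (EuclideanSpace ℝ (Fin N))))
  have h3 : Measurable fun z : EuclideanSpace ℝ (Fin N) × EuclideanSpace ℝ (Fin N) =>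
      ‖z.1 - z.2‖ ^ p := by fun_prop
  exact (h2.aemeasurable.div h3.aemeasurable).aestronglyMeasurable

lemma aestronglyMeasurable_formIntegrand (hp : 1 < p) (hk : IsHorizonKernel p s c₀ δ e k)
    {S : Set (EuclideanSpace ℝ (Fin N))}
    (hu : AEStronglyMeasurable u (volume.restrict S))
    (hv : AEStronglyMeasurable v (volume.restrict S)) :
    AEStronglyMeasurable (formIntegrand p k u v) (volume.restrict (S ×ˢ S)) := by
  have hd := (aestronglyMeasurable_fst_restrict hu).sub (aestronglyMeasurable_snd_restrict hu)
  have hd' := (aestronglyMeasurable_fst_restrict hv).sub (aestronglyMeasurable_snd_restrict hv)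
  have := ((aestronglyMeasurable_kernelWeight hk).restrict (s := S ×ˢ S)).mul
    (((continuous_abs_rpow_sub_two_mul hp).comp_aestronglyMeasurable hd).mul hd')
  refine this.congr (ae_of_all _ fun z => ?_)
  rw [formIntegrand_eq]
  rfl

/-- The mixed integrand is dominated pointwise by the sum of the energy densities of `u` and `v`. -/
lemma integrableOn_formIntegrand (hp : 1 < p) (hk : IsHorizonKernel p s c₀ δ e k)
    (hu : u ∈ X Ω p δ k) (hv : v ∈ X Ω p δ k) :
    IntegrableOn (formIntegrand p k u v) (extendedDomain Ω δ ×ˢ extendedDomain Ω δ) := by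
  refine Integrable.mono' (hu.2.add hv.2) (aestronglyMeasurable_formIntegrand hp hk
    hu.1.aestronglyMeasurable hv.1.aestronglyMeasurable) (ae_of_all _ fun z => ?_)
  rw [Pi.add_apply, formIntegrand_self hp, formIntegrand_self hp, formIntegrand_eq, ← mul_add,
    Real.norm_eq_abs, abs_mul, abs_of_nonneg (kernelWeight_nonneg hk z), abs_mul,
    abs_rpow_sub_two_mul_abs hp]
  gcongr
  · exact kernelWeight_nonneg hk z
  · exact rpow_sub_one_mul_le hp (abs_nonneg _) (abs_nonneg _)

lemma sub_mem_X (hp : 1 < p) (hk : IsHorizonKernel p s c₀ δ e k)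
    (hu : u ∈ X Ω p δ k) (hv : v ∈ X Ω p δ k) : u - v ∈ X Ω p δ k := by
  refine ⟨hu.1.sub hv.1, Integrable.mono' ((hu.2.add hv.2).const_mul (2 ^ p))
    (aestronglyMeasurable_formIntegrand hp hk (hu.1.sub hv.1).aestronglyMeasurable
      (hu.1.sub hv.1).aestronglyMeasurable) (ae_of_all _ fun z => ?_)⟩
  have hκ := kernelWeight_nonneg hk z
  rw [Pi.add_apply, formIntegrand_self hp, formIntegrand_self hp, formIntegrand_self hp,
    Real.norm_eq_abs, abs_of_nonneg (by positivity)]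
  calc kernelWeight p k z * |(u - v) z.1 - (u - v) z.2| ^ p
      = kernelWeight p k z * |(u z.1 - u z.2) - (v z.1 - v z.2)| ^ p := by
        simp only [Pi.sub_apply]; ring_nf
    _ ≤ kernelWeight p k z * (2 ^ p * (|u z.1 - u z.2| ^ p + |v z.1 - v z.2| ^ p)) := by
        gcongr; exact abs_sub_rpow_le hp _ _
    _ = _ := by ring

lemma sub_mem_X₀ (hp : 1 < p) (hk : IsHorizonKernel p s c₀ δ e k)
    {u₀ : EuclideanSpace ℝ (Fin N) → ℝ} (hu : u ∈ X Ω p δ k) (hv : v ∈ X Ω p δ k)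
    (hub : ∀ᵐ x ∂(volume.restrict (extendedDomain Ω δ \ Ω)), u x = u₀ x)
    (hvb : ∀ᵐ x ∂(volume.restrict (extendedDomain Ω δ \ Ω)), v x = u₀ x) :
    u - v ∈ X₀ Ω p δ k := by
  refine ⟨sub_mem_X hp hk hu hv, ?_⟩
  filter_upwards [hub, hvb] with x h1 h2
  simp [h1, h2]

lemma IsDiffusionCoefficient.ae_extendedDomain (hΩ : IsOpen Ω)
    (hh : IsDiffusionCoefficient Ω δ hmin hmax h) :
    ∀ᵐ x ∂(volume.restrict (extendedDomain Ω δ)),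
      (x ∈ Ω → h x ∈ Icc hmin hmax) ∧ (x ∉ Ω → h x = 0) := by
  have hS : MeasurableSet (extendedDomain Ω δ) := (isOpen_extendedDomain hΩ).measurableSet
  rw [ae_restrict_iff' hS]
  filter_upwards [(ae_restrict_iff' hΩ.measurableSet).1 hh.mem_Icc,
    (ae_restrict_iff' (hS.diff hΩ.measurableSet)).1 hh.eq_zero] with x h1 h2 hx
  exact ⟨h1, fun hx' => h2 ⟨hx, hx'⟩⟩

lemma IsDiffusionCoefficient.ae_mem_Icc_zero (hΩ : IsOpen Ω) (hmin_pos : 0 < hmin)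
    (hmin_lt : hmin < hmax) (hh : IsDiffusionCoefficient Ω δ hmin hmax h) :
    ∀ᵐ z ∂((volume : Measure (EuclideanSpace ℝ (Fin N) × EuclideanSpace ℝ (Fin N))).restrict
      (extendedDomain Ω δ ×ˢ extendedDomain Ω δ)), (h z.1 + h z.2) / 2 ∈ Icc 0 hmax := by
  have h1 : ∀ᵐ x ∂(volume.restrict (extendedDomain Ω δ)), h x ∈ Icc 0 hmax := by
    filter_upwards [hh.ae_extendedDomain hΩ] with x hx
    by_cases hxΩ : x ∈ Ω
    · exact ⟨hmin_pos.le.trans (hx.1 hxΩ).1, (hx.1 hxΩ).2⟩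
    · rw [hx.2 hxΩ]; exact ⟨le_rfl, (hmin_pos.trans hmin_lt).le⟩
  filter_upwards [ae_restrict_prod_self h1] with z hz
  obtain ⟨⟨a, b⟩, c, d⟩ := hz
  constructor <;> linarith

lemma integrableOn_Bh (hΩ : IsOpen Ω) (hp : 1 < p) (hmin_pos : 0 < hmin)
    (hmin_lt : hmin < hmax) (hk : IsHorizonKernel p s c₀ δ e k)
    (hh : IsDiffusionCoefficient Ω δ hmin hmax h)
    (hu : u ∈ X Ω p δ k) (hv : v ∈ X Ω p δ k) :
    IntegrableOn (fun z => ((h z.1 + h z.2) / 2) * formIntegrand p k u v z)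
      (extendedDomain Ω δ ×ˢ extendedDomain Ω δ) := by
  have hm : AEStronglyMeasurable
      (fun z : EuclideanSpace ℝ (Fin N) × EuclideanSpace ℝ (Fin N) => (h z.1 + h z.2) / 2)
      (volume.restrict (extendedDomain Ω δ ×ˢ extendedDomain Ω δ)) :=
    (((aestronglyMeasurable_fst_restrict hh.aemeasurable.aestronglyMeasurable).add
      (aestronglyMeasurable_snd_restrict hh.aemeasurable.aestronglyMeasurable)).aemeasurable.div_const
        2).aestronglyMeasurable
  refine Integrable.bdd_mul (c := hmax) (integrableOn_formIntegrand hp hk hu hv) hm ?_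
  filter_upwards [hh.ae_mem_Icc_zero hΩ hmin_pos hmin_lt] with z hz
  rw [Real.norm_eq_abs, abs_of_nonneg hz.1]
  exact hz.2

/-- Differences of energies are controlled by the monotonicity of the operator, up to a small
multiple of the energy of the reference function. -/
lemma exists_Bh_sub_le (hΩ : IsOpen Ω) (hp : 1 < p) (hmin_pos : 0 < hmin)
    (hmin_lt : hmin < hmax) (hk : IsHorizonKernel p s c₀ δ e k)
    (hh : IsDiffusionCoefficient Ω δ hmin hmax h) {ε : ℝ} (hε : 0 < ε) :
    ∃ C : ℝ, 0 ≤ C ∧ ∀ u ∈ X Ω p δ k, ∀ v ∈ X Ω p δ k,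
      Bh Ω p δ k h (v - u) (v - u) + |Bh Ω p δ k h v v - Bh Ω p δ k h u u| ≤
        ε * Bh Ω p δ k h u u +
          C * (Bh Ω p δ k h v (v - u) - Bh Ω p δ k h u (v - u)) := by
  obtain ⟨C, hC0, hC⟩ := exists_le_rpow_add_monotone_product hp hε
  refine ⟨C, hC0, fun u hu v hv => ?_⟩
  have hint : ∀ {f g}, f ∈ X Ω p δ k → g ∈ X Ω p δ k → _ := fun {f g} hf hg =>
    integrableOn_Bh hΩ hp hmin_pos hmin_lt hk hh (u := f) (v := g) hf hg
  have hw := sub_mem_X hp hk hv hu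
  set S := extendedDomain Ω δ
  calc Bh Ω p δ k h (v - u) (v - u) + |Bh Ω p δ k h v v - Bh Ω p δ k h u u|
      ≤ Bh Ω p δ k h (v - u) (v - u) + ∫ z in S ×ˢ S,
        |((h z.1 + h z.2) / 2) * formIntegrand p k v v z -
          ((h z.1 + h z.2) / 2) * formIntegrand p k u u z| := by
        gcongr
        rw [Bh, Bh, ← integral_sub (hint hv hv) (hint hu hu)]
        exact abs_integral_le_integral_abs
    _ = ∫ z in S ×ˢ S, (((h z.1 + h z.2) / 2) * formIntegrand p k (v - u) (v - u) z +
          |((h z.1 + h z.2) / 2) * formIntegrand p k v v z -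
            ((h z.1 + h z.2) / 2) * formIntegrand p k u u z|) :=
        (integral_add (hint hw hw) ((hint hv hv).sub (hint hu hu)).abs).symm
    _ ≤ ∫ z in S ×ˢ S, (ε * (((h z.1 + h z.2) / 2) * formIntegrand p k u u z) +
          C * (((h z.1 + h z.2) / 2) * formIntegrand p k v (v - u) z -
            ((h z.1 + h z.2) / 2) * formIntegrand p k u (v - u) z)) := by
        refine integral_mono_ae
          ((hint hw hw).add ((hint hv hv).sub (hint hu hu)).abs)
          (((hint hu hu).const_mul ε).add (((hint hv hw).sub (hint hu hw)).const_mul C)) ?_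
        filter_upwards [hh.ae_mem_Icc_zero hΩ hmin_pos hmin_lt] with z hz
        have hκ := kernelWeight_nonneg hk z
        have h0 := mul_nonneg hz.1 hκ
        -- The scalar inequality for the differences of `v` and of `u`, multiplied by the
        -- nonnegative weight `H` times the kernel weight.
        have key := mul_le_mul_of_nonneg_left (hC (v z.1 - v z.2) (u z.1 - u z.2)) h0
        have hd : (v - u) z.1 - (v - u) z.2 = (v z.1 - v z.2) - (u z.1 - u z.2) := by
          simp only [Pi.sub_apply]; ring
        simp only [formIntegrand_self hp]
        rw [formIntegrand_eq v, formIntegrand_eq u, hd, ← mul_sub, ← mul_sub, abs_mul,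
          abs_mul (kernelWeight p k z), abs_of_nonneg hz.1, abs_of_nonneg hκ]
        refine le_trans (le_of_eq ?_) (key.trans (le_of_eq ?_)) <;> ring
    _ = _ := by
        refine (integral_add ((hint hu hu).const_mul ε)
          (((hint hv hw).sub (hint hu hw)).const_mul C)).trans ?_
        rw [integral_const_mul, integral_const_mul, integral_sub' (hint hv hw) (hint hu hw)]
        rfl

lemma B_self_nonneg (hp : 1 < p) (hk : IsHorizonKernel p s c₀ δ e k) : 0 ≤ B Ω p δ k u u :=
  integral_nonneg fun z => by
    rw [formIntegrand_self hp]
    exact mul_nonneg (kernelWeight_nonneg hk z) (by positivity)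

lemma ae_extendedDomain_of_mem_X₀ (hΩ : IsOpen Ω) (hw : w ∈ X₀ Ω p δ k) :
    ∀ᵐ x ∂(volume.restrict (extendedDomain Ω δ)), x ∉ Ω → w x = 0 := by
  have hS : MeasurableSet (extendedDomain Ω δ) := (isOpen_extendedDomain hΩ).measurableSet
  rw [ae_restrict_iff' hS]
  filter_upwards [(ae_restrict_iff' (hS.diff hΩ.measurableSet)).1 hw.2] with x h2 hx hx'
  exact h2 ⟨hx, hx'⟩

/-- The factor `H` vanishes only when both points lie outside `Ω`, up to null sets, and there the
difference of `w` vanishes as well. Every other pair has a point in `Ω`, so `H ≥ hmin / 2`. -/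
lemma B_le_Bh_of_mem_X₀ (hΩ : IsOpen Ω) (hp : 1 < p) (hmin_pos : 0 < hmin)
    (hmin_lt : hmin < hmax) (hk : IsHorizonKernel p s c₀ δ e k)
    (hh : IsDiffusionCoefficient Ω δ hmin hmax h) (hw : w ∈ X₀ Ω p δ k) :
    B Ω p δ k w w ≤ 2 / hmin * Bh Ω p δ k h w w := by
  rw [B, Bh, ← integral_const_mul]
  refine integral_mono_ae hw.1.2
    ((integrableOn_Bh hΩ hp hmin_pos hmin_lt hk hh hw.1 hw.1).const_mul _) ?_
  filter_upwards [ae_restrict_prod_self (hh.ae_extendedDomain hΩ),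
    ae_restrict_prod_self (ae_extendedDomain_of_mem_X₀ hΩ hw)] with z hz hwz
  have hκ := kernelWeight_nonneg hk z
  have hnn : ∀ x, (x ∈ Ω → h x ∈ Icc hmin hmax) ∧ (x ∉ Ω → h x = 0) → 0 ≤ h x := fun x hx => by
    by_cases hxΩ : x ∈ Ω
    · exact hmin_pos.le.trans (hx.1 hxΩ).1
    · rw [hx.2 hxΩ]
  have h1 := hnn _ hz.1
  have h2 := hnn _ hz.2
  rw [formIntegrand_self hp]
  by_cases hmem : z.1 ∈ Ω ∨ z.2 ∈ Ω
  · have hge : hmin ≤ h z.1 + h z.2 := by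
      rcases hmem with hm | hm
      · have := (hz.1.1 hm).1; linarith
      · have := (hz.2.1 hm).1; linarith
    calc kernelWeight p k z * |w z.1 - w z.2| ^ p
        = 1 * (kernelWeight p k z * |w z.1 - w z.2| ^ p) := (one_mul _).symm
      _ ≤ (2 / hmin * ((h z.1 + h z.2) / 2)) * (kernelWeight p k z * |w z.1 - w z.2| ^ p) := by
        gcongr
        rw [div_mul_div_comm, le_div_iff₀ (by positivity)]
        linarith
      _ = _ := by ring
  · rw [not_or] at hmem
    simp [hwz.1 hmem.1, hwz.2 hmem.2, Real.zero_rpow (by linarith : p ≠ 0)]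

end Forms

/-! ### Nonlocal Poincaré inequality -/

section Poincare

variable {N : ℕ} {Ω : Set (EuclideanSpace ℝ (Fin N))} {p s c₀ δ hmin hmax : ℝ}
  {e : EuclideanSpace ℝ (Fin N)} {k : ℝ → ℝ} {w W : EuclideanSpace ℝ (Fin N) → ℝ}

/-- For `y ∉ Ω` the distance to `Ω` is attained at a boundary point, and it is at most `dist y x <
δ`. -/
lemma mem_extendedDomain_of_dist_lt {x y : EuclideanSpace ℝ (Fin N)} (hx : x ∈ Ω)
    (hxy : dist y x < δ) : y ∈ extendedDomain Ω δ := by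
  by_cases hy : y ∈ Ω
  · exact Or.inl hy
  · have hne : Ωᶜ ≠ univ := fun h => by
      have : x ∈ Ωᶜ := h ▸ mem_univ x
      exact this hx
    obtain ⟨b, hb, hdist⟩ := exists_mem_frontier_infDist_compl_eq_dist (s := Ωᶜ) hy hne
    rw [frontier_compl] at hb
    rw [compl_compl] at hdist
    refine Or.inr (mem_biUnion hb ?_)
    rw [mem_ball, ← hdist]
    exact (infDist_le_dist_of_mem hx).trans_lt hxy

/-- Elements of `X₀` have a measurable representative that is extended by zero to the whole
space. -/
lemma exists_measurable_extension (hΩ : IsOpen Ω) (hw : w ∈ X₀ Ω p δ k) :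
    ∃ W : EuclideanSpace ℝ (Fin N) → ℝ, Measurable W ∧ (∀ x, x ∉ Ω → W x = 0) ∧
      W =ᵐ[volume.restrict (extendedDomain Ω δ)] w := by
  have hm := hw.1.1.aestronglyMeasurable
  refine ⟨Ω.indicator (hm.mk w), hm.stronglyMeasurable_mk.measurable.indicator hΩ.measurableSet,
    fun x hx => indicator_of_notMem hx _, ?_⟩
  filter_upwards [hm.ae_eq_mk, ae_extendedDomain_of_mem_X₀ hΩ hw] with x h1 h2
  by_cases hx : x ∈ Ω
  · rw [indicator_of_mem hx, h1]
  · rw [indicator_of_notMem hx, h2 hx]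

/-- The lower bound on `k` makes the kernel weight at least `c₀ r^(-N-sp)` at distance `r`, hence at
least `c₀ ρ^(-N-sp)` for `r < ρ`. On the diagonal, where that bound says nothing, the left side is
zero. -/
lemma abs_rpow_le_formIntegrand (hp : 1 < p) (hs : 0 < s) (hc₀ : 0 < c₀)
    (hk : IsHorizonKernel p s c₀ δ e k) {ρ : ℝ} (hρ : ρ ≤ δ)
    {z : EuclideanSpace ℝ (Fin N) × EuclideanSpace ℝ (Fin N)} (hz : ‖z.1 - z.2‖ < ρ) :
    |w z.1 - w z.2| ^ p ≤ ρ ^ ((N : ℝ) + s * p) / c₀ * formIntegrand p k w w z := by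
  rw [formIntegrand_self hp]
  have hp0 : 0 < p := by linarith
  rcases (norm_nonneg (z.1 - z.2)).eq_or_lt with h0 | hpos
  · have : z.1 = z.2 := sub_eq_zero.1 (norm_eq_zero.1 h0.symm)
    simp [this, Real.zero_rpow hp0.ne']
  have hρ0 : 0 < ρ := hpos.trans hz
  have hlow := hk.lower_bound _ hpos (hz.trans_le hρ)
  set r := ‖z.1 - z.2‖ with hr
  have h1 : c₀ / r ^ ((N : ℝ) + s * p) ≤ kernelWeight p k z := by
    rw [kernelWeight, ← hr, le_div_iff₀ (by positivity)]
    refine le_trans (le_of_eq ?_) hlow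
    rw [show (N : ℝ) + s * p = ((N : ℝ) + (s - 1) * p) + p by ring, Real.rpow_add hpos]
    field_simp
  have h2 : r ^ ((N : ℝ) + s * p) ≤ ρ ^ ((N : ℝ) + s * p) :=
    Real.rpow_le_rpow hpos.le hz.le (by positivity)
  have h3 : 1 ≤ ρ ^ ((N : ℝ) + s * p) / c₀ * kernelWeight p k z := by
    calc (1 : ℝ) = r ^ ((N : ℝ) + s * p) / c₀ * (c₀ / r ^ ((N : ℝ) + s * p)) := by field_simp
      _ ≤ _ := by gcongr
  calc |w z.1 - w z.2| ^ p = 1 * |w z.1 - w z.2| ^ p := (one_mul _).symm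
    _ ≤ (ρ ^ ((N : ℝ) + s * p) / c₀ * kernelWeight p k z) * |w z.1 - w z.2| ^ p := by gcongr
    _ = _ := by ring

/-- The integral over the whole space sees nothing beyond `Ω_δ × Ω_δ`: a pair at distance below `δ`
with one point in `Ω` lies in this product, and any other such pair contributes zero. The factor
`ρ^(N+sp)` exceeds the order `ρ^N` of a ball's volume by `ρ^(sp)`, which is what later makes this
term small. -/
lemma integral_near_diagonal_le (hΩ : IsOpen Ω) (hp : 1 < p) (hs : 0 < s) (hc₀ : 0 < c₀)
    (hk : IsHorizonKernel p s c₀ δ e k) (hw : w ∈ X Ω p δ k)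
    (hWm : Measurable W) (hW0 : ∀ x, x ∉ Ω → W x = 0)
    (hWw : W =ᵐ[volume.restrict (extendedDomain Ω δ)] w) {ρ : ℝ} (hρ0 : 0 < ρ) (hρ : ρ ≤ δ) :
    Integrable ({z : EuclideanSpace ℝ (Fin N) × EuclideanSpace ℝ (Fin N) |
        ‖z.1 - z.2‖ < ρ}.indicator fun z => |W z.1 - W z.2| ^ p) ∧
      ∫ z, {z : EuclideanSpace ℝ (Fin N) × EuclideanSpace ℝ (Fin N) |
        ‖z.1 - z.2‖ < ρ}.indicator (fun z => |W z.1 - W z.2| ^ p) z ≤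
        ρ ^ ((N : ℝ) + s * p) / c₀ * B Ω p δ k w w := by
  have hp0 : 0 < p := by linarith
  set T := {z : EuclideanSpace ℝ (Fin N) × EuclideanSpace ℝ (Fin N) | ‖z.1 - z.2‖ < ρ} with hT
  set S := extendedDomain Ω δ with hS
  have hSm : MeasurableSet (S ×ˢ S) :=
    (isOpen_extendedDomain hΩ).measurableSet.prod (isOpen_extendedDomain hΩ).measurableSet
  have hTm : MeasurableSet T := measurableSet_lt (by fun_prop) (by fun_prop)
  set F := (S ×ˢ S).indicator
    (fun z => ρ ^ ((N : ℝ) + s * p) / c₀ * formIntegrand p k w w z) with hF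
  have hFi : Integrable F :=
    (integrable_indicator_iff hSm).2 (Integrable.const_mul hw.2 _)
  have hle : ∀ᵐ z, T.indicator (fun z => |W z.1 - W z.2| ^ p) z ≤ F z := by
    filter_upwards [(ae_restrict_iff' hSm).1 (ae_restrict_prod_self hWw)] with z hz
    have hFnn : 0 ≤ F z := indicator_nonneg (fun z _ => by
      rw [formIntegrand_self hp]
      have := kernelWeight_nonneg hk z
      positivity) z
    by_cases hzT : z ∈ T
    · rw [indicator_of_mem hzT]
      by_cases hzS : z ∈ S ×ˢ S
      · rw [hF, indicator_of_mem hzS, (hz hzS).1, (hz hzS).2]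
        exact abs_rpow_le_formIntegrand hp hs hc₀ hk hρ hzT
      · have h1 : z.1 ∉ Ω := fun h => hzS ⟨subset_extendedDomain h,
          mem_extendedDomain_of_dist_lt h (by
            rw [dist_comm, dist_eq_norm]; exact lt_of_lt_of_le hzT hρ)⟩
        have h2 : z.2 ∉ Ω := fun h => hzS ⟨mem_extendedDomain_of_dist_lt h (by
            rw [dist_eq_norm]; exact lt_of_lt_of_le hzT hρ), subset_extendedDomain h⟩
        rw [hW0 _ h1, hW0 _ h2]
        simpa [Real.zero_rpow hp0.ne'] using hFnn
    · rw [indicator_of_notMem hzT]; exact hFnn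
  have hnn : ∀ z, 0 ≤ T.indicator (fun z => |W z.1 - W z.2| ^ p) z :=
    fun z => indicator_nonneg (fun z _ => by positivity) z
  have hint : Integrable (T.indicator fun z => |W z.1 - W z.2| ^ p) := by
    refine hFi.mono' ?_ (hle.mono fun z hz => ?_)
    · have : Measurable fun z : EuclideanSpace ℝ (Fin N) × EuclideanSpace ℝ (Fin N) =>
        |W z.1 - W z.2| ^ p :=
        (continuous_abs.measurable.comp
          ((hWm.comp measurable_fst).sub (hWm.comp measurable_snd))).pow_const p
      exact (this.indicator hTm).aestronglyMeasurable
    · rwa [Real.norm_eq_abs, abs_of_nonneg (hnn z)]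
  refine ⟨hint, (integral_mono_ae hint hFi hle).trans (le_of_eq ?_)⟩
  rw [hF, integral_indicator hSm, integral_const_mul, B]

/-- Telescoping along the steps `z`, with Minkowski's inequality and translation invariance of the
norm. -/
lemma eLpNorm_translate_nsmul_sub_le {q : ENNReal} (hq : 1 ≤ q) (hWm : Measurable W)
    (z : EuclideanSpace ℝ (Fin N)) (n : ℕ) :
    eLpNorm (fun x => W (x + n • z) - W x) q volume ≤
      n * eLpNorm (fun x => W (x + z) - W x) q volume := by
  have hm : ∀ y : EuclideanSpace ℝ (Fin N), Measurable fun x => W (x + y) - W x := fun y =>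
    (hWm.comp (measurable_add_const y)).sub hWm
  induction n with
  | zero => simp
  | succ n ih =>
    have h1 : (fun x => W (x + (n + 1) • z) - W x) =
        ((fun x => W (x + z) - W x) ∘ fun x => x + n • z) + fun x => W (x + n • z) - W x := by
      ext x
      simp only [Function.comp, Pi.add_apply, succ_nsmul, ← add_assoc]
      ring
    rw [h1]
    refine (eLpNorm_add_le ((hm z).comp (measurable_add_const _)).aestronglyMeasurable
      (hm _).aestronglyMeasurable hq).trans ?_
    rw [eLpNorm_comp_measurePreserving (hm z).aestronglyMeasurable
      (measurePreserving_add_right volume (n • z))]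
    calc _ ≤ eLpNorm (fun x => W (x + z) - W x) q volume +
          n * eLpNorm (fun x => W (x + z) - W x) q volume := by gcongr
      _ = _ := by push_cast; ring

/-- If translation by `n • z` moves `Ω` off itself, then `|W x| ≤ |W (x + n • z) - W x|` everywhere:
one of the two values is zero for `x ∈ Ω`, and `W x = 0` otherwise. -/
lemma lintegral_enorm_rpow_le_translate (hp : 1 < p) (hWm : Measurable W)
    (hW0 : ∀ x, x ∉ Ω → W x = 0) {z : EuclideanSpace ℝ (Fin N)} {n : ℕ}
    (hz : ∀ x ∈ Ω, x + n • z ∉ Ω) :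
    ∫⁻ x, ‖W x‖ₑ ^ p ≤ (n : ENNReal) ^ p * ∫⁻ x, ‖W (x + z) - W x‖ₑ ^ p := by
  have hp0 : 0 < p := by linarith
  have hq0 : ENNReal.ofReal p ≠ 0 := by simpa using hp0
  have hq : (1 : ENNReal) ≤ ENNReal.ofReal p := by
    rw [← ENNReal.ofReal_one]; exact ENNReal.ofReal_le_ofReal hp.le
  have hnorm : ∀ f : EuclideanSpace ℝ (Fin N) → ℝ,
      eLpNorm f (ENNReal.ofReal p) volume ^ p = ∫⁻ x, ‖f x‖ₑ ^ p := fun f => by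
    rw [eLpNorm_eq_lintegral_rpow_enorm_toReal hq0 ENNReal.ofReal_ne_top,
      ENNReal.toReal_ofReal hp0.le, ← ENNReal.rpow_mul, one_div_mul_cancel hp0.ne',
      ENNReal.rpow_one]
  have h1 : eLpNorm W (ENNReal.ofReal p) volume ≤
      eLpNorm (fun x => W (x + n • z) - W x) (ENNReal.ofReal p) volume := by
    refine eLpNorm_mono fun x => ?_
    by_cases hx : x ∈ Ω
    · simp [hW0 _ (hz x hx)]
    · simp [hW0 x hx]
  have h2 := h1.trans (eLpNorm_translate_nsmul_sub_le hq hWm z n)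
  calc ∫⁻ x, ‖W x‖ₑ ^ p = eLpNorm W (ENNReal.ofReal p) volume ^ p := (hnorm W).symm
    _ ≤ (n * eLpNorm (fun x => W (x + z) - W x) (ENNReal.ofReal p) volume) ^ p := by gcongr
    _ = _ := by rw [ENNReal.mul_rpow_of_nonneg _ _ hp0.le, hnorm]

/-- Nonlocal Poincaré inequality on `X₀`. -/
lemma exists_poincare (hΩ : IsOpen Ω) (hΩb : Bornology.IsBounded Ω) (hp : 1 < p) (hs : 0 < s)
    (hc₀ : 0 < c₀) (hδ : 0 < δ) (he : ‖e‖ = 1) (hk : IsHorizonKernel p s c₀ δ e k) :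
    ∃ C : ℝ, 0 ≤ C ∧ ∀ w ∈ X Ω p δ k, ∀ W : EuclideanSpace ℝ (Fin N) → ℝ, Measurable W →
      (∀ x, x ∉ Ω → W x = 0) → W =ᵐ[volume.restrict (extendedDomain Ω δ)] w →
      ∫⁻ x, ‖W x‖ₑ ^ p ≤ ENNReal.ofReal (C * B Ω p δ k w w) := by
  obtain ⟨R, hR⟩ := hΩb.exists_norm_le
  -- With `R` a bound for `Ω`, `n` steps longer than `δ/2` cover more than `2R` and so leave `Ω`.
  obtain ⟨n, hn⟩ := exists_nat_gt (2 * R / (δ / 2))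
  rw [div_lt_iff₀ (by positivity)] at hn
  -- A set of positive volume inside the shell `δ/2 < ‖z‖ < δ`: its steps are long enough for the
  -- choice of `n`, yet shorter than the horizon. Averaging the translation estimate over `A`
  -- produces the double integral.
  set A := ball ((3 * δ / 4) • e) (δ / 4) with hA
  have hnormA : ∀ z ∈ A, δ / 2 < ‖z‖ ∧ ‖z‖ < δ := fun z hz => by
    have hc : ‖(3 * δ / 4) • e‖ = 3 * δ / 4 := by
      rw [norm_smul, he, mul_one, Real.norm_of_nonneg (by positivity)]
    rw [hA, mem_ball, dist_eq_norm] at hz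
    have h1 := norm_sub_norm_le z ((3 * δ / 4) • e)
    have h2 := norm_sub_norm_le ((3 * δ / 4) • e) z
    rw [norm_sub_rev] at h2
    constructor <;> linarith
  have hApos : 0 < volume A := measure_ball_pos _ _ (by positivity)
  have hAfin : volume A ≠ ⊤ := measure_ball_lt_top.ne
  set V := (volume A).toReal with hV
  have hVpos : 0 < V := ENNReal.toReal_pos hApos.ne' hAfin
  refine ⟨(n : ℝ) ^ p * (δ ^ ((N : ℝ) + s * p) / c₀) / V, by positivity,
    fun w hw W hWm hW0 hWw => ?_⟩
  obtain ⟨hint, hle⟩ := integral_near_diagonal_le hΩ hp hs hc₀ hk hw hWm hW0 hWw hδ le_rfl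
  set T := {z : EuclideanSpace ℝ (Fin N) × EuclideanSpace ℝ (Fin N) | ‖z.1 - z.2‖ < δ} with hT
  have hAm : MeasurableSet A := measurableSet_ball
  have hmeas : Measurable fun q : EuclideanSpace ℝ (Fin N) × EuclideanSpace ℝ (Fin N) =>
      ‖W q.1 - W q.2‖ₑ ^ p :=
    ((hWm.comp measurable_fst).sub (hWm.comp measurable_snd)).enorm.pow_const p
  have htrans : ∀ z ∈ A, ∫⁻ x, ‖W x‖ₑ ^ p ≤
      (n : ENNReal) ^ p * ∫⁻ x, ‖W (x + z) - W x‖ₑ ^ p := fun z hz => by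
    refine lintegral_enorm_rpow_le_translate hp hWm hW0 fun x hx hx' => ?_
    have h1 : ‖n • z‖ ≤ 2 * R := by
      have := norm_sub_le (x + n • z) x
      rw [add_sub_cancel_left] at this
      linarith [hR x hx, hR _ hx']
    rw [← Nat.cast_smul_eq_nsmul ℝ, norm_smul, Real.norm_natCast] at h1
    have h2 : (n : ℝ) * (δ / 2) ≤ n * ‖z‖ := by
      gcongr; exact (hnormA z hz).1.le
    linarith
  -- The substitution `y = x + z` sends `z ∈ A` to pairs `(y, x)` at distance below `δ`.
  have hswap : ∫⁻ z in A, ∫⁻ x, ‖W (x + z) - W x‖ₑ ^ p ≤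
      ∫⁻ q, ENNReal.ofReal (T.indicator (fun z => |W z.1 - W z.2| ^ p) q) := by
    rw [lintegral_lintegral_swap, Measure.volume_eq_prod, lintegral_prod_symm]
    · refine lintegral_mono fun x => ?_
      simp only
      rw [← lintegral_add_left_eq_self (fun y => ENNReal.ofReal
        (T.indicator (fun z => |W z.1 - W z.2| ^ p) (y, x))) x, ← lintegral_indicator hAm]
      refine lintegral_mono fun z => ?_
      by_cases hz : z ∈ A
      · have : (x + z, x) ∈ T := by simpa [hT] using (hnormA z hz).2
        rw [indicator_of_mem hz, indicator_of_mem this,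
          ← ENNReal.ofReal_rpow_of_nonneg (abs_nonneg _) (by linarith), ← Real.norm_eq_abs,
          ofReal_norm]
      · rw [indicator_of_notMem hz]; exact zero_le
    · exact hint.aestronglyMeasurable.aemeasurable.ennreal_ofReal
    · exact (hmeas.comp (f := fun q : EuclideanSpace ℝ (Fin N) × EuclideanSpace ℝ (Fin N) =>
        (q.2 + q.1, q.2)) (by fun_prop)).aemeasurable
  have hnn : ∀ q, 0 ≤ T.indicator (fun z => |W z.1 - W z.2| ^ p) q :=
    fun q => indicator_nonneg (fun z _ => by positivity) q
  rw [← ofReal_integral_eq_lintegral_ofReal hint (ae_of_all _ hnn)] at hswap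
  have hmain : volume A * ∫⁻ x, ‖W x‖ₑ ^ p ≤ (n : ENNReal) ^ p *
      ENNReal.ofReal (δ ^ ((N : ℝ) + s * p) / c₀ * B Ω p δ k w w) := by
    calc volume A * ∫⁻ x, ‖W x‖ₑ ^ p = ∫⁻ _ in A, ∫⁻ x, ‖W x‖ₑ ^ p := by
          rw [setLIntegral_const, mul_comm]
      _ ≤ ∫⁻ z in A, (n : ENNReal) ^ p * ∫⁻ x, ‖W (x + z) - W x‖ₑ ^ p :=
          setLIntegral_mono' hAm htrans
      _ = (n : ENNReal) ^ p * ∫⁻ z in A, ∫⁻ x, ‖W (x + z) - W x‖ₑ ^ p :=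
          lintegral_const_mul' _ _ (by finiteness)
      _ ≤ _ := by gcongr; exact hswap.trans (ENNReal.ofReal_le_ofReal hle)
  have hn' : (n : ENNReal) ^ p = ENNReal.ofReal ((n : ℝ) ^ p) := by
    rw [← ENNReal.ofReal_rpow_of_nonneg (by positivity) (by linarith), ENNReal.ofReal_natCast]
  rw [hn', ← ENNReal.ofReal_mul (by positivity), ← ENNReal.ofReal_toReal hAfin, ← hV, mul_comm,
    ← ENNReal.le_div_iff_mul_le (Or.inl (by simpa using hVpos)) (Or.inl ENNReal.ofReal_ne_top),
    ← ENNReal.ofReal_div_of_pos hVpos] at hmain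
  refine hmain.trans (le_of_eq ?_)
  congr 1
  ring

end Poincare

/-! ### Averaging over small balls -/

section Averaging

variable {N : ℕ} {Ω : Set (EuclideanSpace ℝ (Fin N))} {p q s c₀ δ ρ : ℝ}
  {e : EuclideanSpace ℝ (Fin N)} {k : ℝ → ℝ} {w W G : EuclideanSpace ℝ (Fin N) → ℝ}

/-- The indicator function of the ball of radius `ρ` around the origin. -/
noncomputable def ballIndicator (N : ℕ) (ρ : ℝ) : EuclideanSpace ℝ (Fin N) → ℝ :=
  (ball 0 ρ).indicator 1

lemma integrable_ballIndicator : Integrable (ballIndicator N ρ) :=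
  (integrable_indicator_iff measurableSet_ball).2
    (integrableOn_const measure_ball_lt_top.ne)

lemma measurable_ballIndicator : Measurable (ballIndicator N ρ) :=
  measurable_one.indicator measurableSet_ball

lemma ballIndicator_nonneg (x : EuclideanSpace ℝ (Fin N)) : 0 ≤ ballIndicator N ρ x :=
  indicator_nonneg (fun _ _ => zero_le_one) x

lemma ballIndicator_le_one (x : EuclideanSpace ℝ (Fin N)) : ballIndicator N ρ x ≤ 1 :=
  indicator_le_self' (fun _ _ => zero_le_one) x

lemma norm_ballIndicator_le_one (x : EuclideanSpace ℝ (Fin N)) : ‖ballIndicator N ρ x‖ ≤ 1 := by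
  rw [Real.norm_of_nonneg (ballIndicator_nonneg x)]
  exact ballIndicator_le_one x

lemma integral_ballIndicator :
    ∫ x, ballIndicator N ρ x = volume.real (ball (0 : EuclideanSpace ℝ (Fin N)) ρ) := by
  rw [ballIndicator, integral_indicator_one measurableSet_ball]

/-- The function `y ↦ ∫ f` over the ball of radius `ρ` around `y`. -/
noncomputable def ballIntegral (ρ : ℝ) (f : EuclideanSpace ℝ (Fin N) → ℝ) (y : EuclideanSpace ℝ (Fin N)) : ℝ :=
  ∫ x, f x * ballIndicator N ρ (y - x)

lemma integrable_mul_ballIndicator {f : EuclideanSpace ℝ (Fin N) → ℝ} (hf : Integrable f) :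
    Integrable fun z : EuclideanSpace ℝ (Fin N) × EuclideanSpace ℝ (Fin N) =>
      f z.2 * ballIndicator N ρ (z.1 - z.2) :=
  hf.convolution_integrand (ContinuousLinearMap.mul ℝ ℝ) integrable_ballIndicator

lemma integral_mul_ballIndicator {f : EuclideanSpace ℝ (Fin N) → ℝ} (hf : Integrable f) :
    ∫ z : EuclideanSpace ℝ (Fin N) × EuclideanSpace ℝ (Fin N),
      f z.2 * ballIndicator N ρ (z.1 - z.2) =
        (∫ x, f x) * volume.real (ball (0 : EuclideanSpace ℝ (Fin N)) ρ) := by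
  rw [← integral_ballIndicator, Measure.volume_eq_prod,
    integral_prod _ (integrable_mul_ballIndicator hf)]
  exact integral_convolution (ContinuousLinearMap.mul ℝ ℝ) hf integrable_ballIndicator

lemma integrable_ballIntegral {f : EuclideanSpace ℝ (Fin N) → ℝ} (hf : Integrable f) :
    Integrable (ballIntegral ρ f) :=
  (integrable_mul_ballIndicator hf).integral_prod_left

lemma abs_ballIntegral_le {f : EuclideanSpace ℝ (Fin N) → ℝ} (hf : Integrable f)
    (y : EuclideanSpace ℝ (Fin N)) : |ballIntegral ρ f y| ≤ ∫ x, |f x| := by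
  rw [ballIntegral, ← Real.norm_eq_abs]
  refine norm_integral_le_of_norm_le hf.abs (ae_of_all _ fun x => ?_)
  rw [norm_mul, Real.norm_eq_abs]
  exact mul_le_of_le_one_right (abs_nonneg _) (norm_ballIndicator_le_one _)

lemma integrable_of_memLp_of_support {r : ℝ} (hr : 1 < r) (hΩb : Bornology.IsBounded Ω) {f : EuclideanSpace ℝ (Fin N) → ℝ}
    (hf : MemLp f (ENNReal.ofReal r) volume) (hf0 : ∀ x, x ∉ Ω → f x = 0) : Integrable f := by
  have : IsFiniteMeasure ((volume : Measure (EuclideanSpace ℝ (Fin N))).restrict Ω) :=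
    isFiniteMeasure_restrict.2 hΩb.measure_lt_top.ne
  have h1 : IntegrableOn f Ω := (hf.restrict Ω).integrable (by
    rw [← ENNReal.ofReal_one]; exact ENNReal.ofReal_le_ofReal hr.le)
  refine (integrableOn_iff_integrable_of_support_subset fun x hx => ?_).1 h1
  by_contra hc
  exact hx (hf0 x hc)

lemma integrable_abs_rpow {r : ℝ} (hr : 1 < r) {μ : Measure (EuclideanSpace ℝ (Fin N))}
    {f : EuclideanSpace ℝ (Fin N) → ℝ}
    (hf : MemLp f (ENNReal.ofReal r) μ) : Integrable (fun x => |f x| ^ r) μ := by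
  have := hf.integrable_norm_rpow (by simpa using (by linarith : 0 < r)) ENNReal.ofReal_ne_top
  simpa [ENNReal.toReal_ofReal (by linarith : 0 ≤ r)] using this

lemma integrable_mul_of_memLp (hpq : p.HolderConjugate q)
    {μ : Measure (EuclideanSpace ℝ (Fin N))}
    (hG : MemLp G (ENNReal.ofReal q) μ) (hW : MemLp W (ENNReal.ofReal p) μ) :
    Integrable (fun x => G x * W x) μ := by
  obtain ⟨C, -, hC⟩ := exists_mul_le_rpow hpq.symm one_pos
  refine Integrable.mono' (((integrable_abs_rpow hpq.symm.lt hG).const_mul 1).add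
    ((integrable_abs_rpow hpq.lt hW).const_mul C))
    (hG.aestronglyMeasurable.mul hW.aestronglyMeasurable) (ae_of_all _ fun x => ?_)
  exact hC _ _

lemma integrableOn_abs_ballIntegral_rpow (hq : 1 < q) (hΩb : Bornology.IsBounded Ω)
    (hG : Integrable G) : IntegrableOn (fun y => |ballIntegral ρ G y| ^ q) Ω := by
  have : IsFiniteMeasure ((volume : Measure (EuclideanSpace ℝ (Fin N))).restrict Ω) :=
    isFiniteMeasure_restrict.2 hΩb.measure_lt_top.ne
  refine Integrable.of_bound (C := (∫ x, |G x|) ^ q) ?_ (ae_of_all _ fun y => ?_)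
  · exact ((integrable_ballIntegral hG).aestronglyMeasurable.restrict.aemeasurable.abs.pow_const
      q).aestronglyMeasurable
  · rw [Real.norm_of_nonneg (by positivity)]
    have := abs_ballIntegral_le (ρ := ρ) hG y
    gcongr

/-- The pairing of `G` and `W` is controlled by the nonlocal energy of `W` near the diagonal
and by the pairing of `W` with the averages of `G`. -/
lemma abs_integral_mul_le (hΩ : IsOpen Ω) (hΩb : Bornology.IsBounded Ω)
    (hpq : p.HolderConjugate q) (hs : 0 < s) (hc₀ : 0 < c₀)
    (hk : IsHorizonKernel p s c₀ δ e k) (hw : w ∈ X Ω p δ k)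
    (hWm : Measurable W) (hW0 : ∀ x, x ∉ Ω → W x = 0)
    (hWw : W =ᵐ[volume.restrict (extendedDomain Ω δ)] w)
    (hWp : MemLp W (ENNReal.ofReal p) volume)
    (hG : MemLp G (ENNReal.ofReal q) volume) (hG0 : ∀ x, x ∉ Ω → G x = 0)
    (hρ0 : 0 < ρ) (hρ : ρ ≤ δ) {τ C τ' C' : ℝ} (hC0 : 0 ≤ C) (hτ0' : 0 ≤ τ')
    (hC : ∀ a b : ℝ, |a * b| ≤ τ * |a| ^ q + C * |b| ^ p)
    (hC' : ∀ a b : ℝ, |a * b| ≤ τ' * |a| ^ p + C' * |b| ^ q) :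
    volume.real (ball (0 : EuclideanSpace ℝ (Fin N)) ρ) * |∫ x, G x * W x| ≤
      τ * (volume.real (ball (0 : EuclideanSpace ℝ (Fin N)) ρ) * ∫ x, |G x| ^ q) +
        C * (ρ ^ ((N : ℝ) + s * p) / c₀ * B Ω p δ k w w) +
        (τ' * ∫ x, |W x| ^ p) + C' * ∫ y in Ω, |ballIntegral ρ G y| ^ q := by
  obtain ⟨hnear, hnear_le⟩ :=
    integral_near_diagonal_le hΩ hpq.lt hs hc₀ hk hw hWm hW0 hWw hρ0 hρ
  set T := {z : EuclideanSpace ℝ (Fin N) × EuclideanSpace ℝ (Fin N) | ‖z.1 - z.2‖ < ρ} with hT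
  set V := volume.real (ball (0 : EuclideanSpace ℝ (Fin N)) ρ) with hV
  have hGi := integrable_of_memLp_of_support hpq.symm.lt hΩb hG hG0
  have hWi := integrable_of_memLp_of_support hpq.lt hΩb hWp hW0
  have hGWi := integrable_mul_of_memLp hpq hG hWp
  have hGq := integrable_abs_rpow hpq.symm.lt hG
  have hWpi := integrable_abs_rpow hpq.lt hWp
  have hA := integrable_mul_ballIndicator (ρ := ρ) hGWi
  have hI2 : Integrable fun z : EuclideanSpace ℝ (Fin N) × EuclideanSpace ℝ (Fin N) =>
      ballIndicator N ρ (z.1 - z.2) * (W z.1 * G z.2) :=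
    Integrable.bdd_mul (c := 1) (hWi.mul_prod hGi)
      (measurable_ballIndicator.comp (measurable_fst.sub measurable_snd)).aestronglyMeasurable
      (ae_of_all _ fun z => norm_ballIndicator_le_one _)
  -- Write `G(x) W(x) = G(x) (W(x) - W(y)) + G(x) W(y)` and integrate over `|x - y| < ρ`. The first
  -- part is paid for by the energy near the diagonal, the second pairs `W` with the ball integrals
  -- of `G`.
  have hsplit : V * ∫ x, G x * W x =
      (∫ z : EuclideanSpace ℝ (Fin N) × EuclideanSpace ℝ (Fin N),
        (G z.2 * W z.2 * ballIndicator N ρ (z.1 - z.2) -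
        ballIndicator N ρ (z.1 - z.2) * (W z.1 * G z.2))) +
      ∫ y, W y * ballIntegral ρ G y := by
    have h1 : ∫ z : EuclideanSpace ℝ (Fin N) × EuclideanSpace ℝ (Fin N),
        ballIndicator N ρ (z.1 - z.2) * (W z.1 * G z.2) = ∫ y, W y * ballIntegral ρ G y := by
      rw [Measure.volume_eq_prod, integral_prod _ hI2]
      refine integral_congr_ae (ae_of_all _ fun y => ?_)
      simp only [ballIntegral, ← integral_const_mul]
      congr 1
      ext x
      ring
    rw [integral_sub hA hI2, integral_mul_ballIndicator hGWi, h1, mul_comm]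
    ring
  have hb1 : |∫ z : EuclideanSpace ℝ (Fin N) × EuclideanSpace ℝ (Fin N),
        (G z.2 * W z.2 * ballIndicator N ρ (z.1 - z.2) -
        ballIndicator N ρ (z.1 - z.2) * (W z.1 * G z.2))| ≤
      τ * (V * ∫ x, |G x| ^ q) + C * (ρ ^ ((N : ℝ) + s * p) / c₀ * B Ω p δ k w w) := by
    have hGb := (integrable_mul_ballIndicator (ρ := ρ) hGq).const_mul τ
    have hnC := hnear.const_mul C
    calc _ ≤ ∫ z : EuclideanSpace ℝ (Fin N) × EuclideanSpace ℝ (Fin N),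
          (τ * (|G z.2| ^ q * ballIndicator N ρ (z.1 - z.2)) +
          C * T.indicator (fun z => |W z.1 - W z.2| ^ p) z) := by
          rw [← Real.norm_eq_abs]
          refine norm_integral_le_of_norm_le (hGb.add hnC) (ae_of_all _ fun z => ?_)
          by_cases hz : z ∈ T
          · have hβ : ballIndicator N ρ (z.1 - z.2) = 1 :=
              indicator_of_mem (by simpa [hT] using hz) _
            rw [hβ, indicator_of_mem hz, Real.norm_eq_abs]
            calc _ = |G z.2 * (W z.1 - W z.2)| := by rw [← abs_neg]; congr 1; ring
              _ ≤ _ := by rw [mul_one]; exact hC _ _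
          · have hβ : ballIndicator N ρ (z.1 - z.2) = 0 :=
              indicator_of_notMem (by simpa [hT] using hz) _
            rw [hβ, indicator_of_notMem hz]
            simp
      _ = τ * (V * ∫ x, |G x| ^ q) +
          C * ∫ z, T.indicator (fun z => |W z.1 - W z.2| ^ p) z := by
          rw [integral_add hGb hnC, integral_const_mul, integral_const_mul,
            integral_mul_ballIndicator hGq, mul_comm V]
      _ ≤ _ := by gcongr
  have hb2 : |∫ y, W y * ballIntegral ρ G y| ≤
      (τ' * ∫ x, |W x| ^ p) + C' * ∫ y in Ω, |ballIntegral ρ G y| ^ q := by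
    have hF : Integrable (Ω.indicator fun y => |ballIntegral ρ G y| ^ q) :=
      (integrable_indicator_iff hΩ.measurableSet).2
        (integrableOn_abs_ballIntegral_rpow hpq.symm.lt hΩb hGi)
    calc _ ≤ ∫ y, (τ' * |W y| ^ p + C' * Ω.indicator (fun y => |ballIntegral ρ G y| ^ q) y) := by
          rw [← Real.norm_eq_abs]
          refine norm_integral_le_of_norm_le ((hWpi.const_mul τ').add (hF.const_mul C'))
            (ae_of_all _ fun y => ?_)
          by_cases hy : y ∈ Ω
          · rw [indicator_of_mem hy]; exact hC' _ _
          · rw [indicator_of_notMem hy, hW0 y hy]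
            simp only [zero_mul, norm_zero, mul_zero, add_zero]
            positivity
      _ = _ := by
          rw [integral_add (hWpi.const_mul τ') (hF.const_mul C'), integral_const_mul,
            integral_const_mul, integral_indicator hΩ.measurableSet]
  calc V * |∫ x, G x * W x| = |V * ∫ x, G x * W x| := by
        rw [abs_mul, abs_of_nonneg measureReal_nonneg]
    _ ≤ _ := by rw [hsplit]; exact (abs_add_le _ _).trans (by linarith)

end Averaging

/-! ### Weak convergence, uniformly in the energy -/

section WeakConvergence

variable {N : ℕ} {Ω : Set (EuclideanSpace ℝ (Fin N))} {p q s c₀ δ ρ : ℝ}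
  {e : EuclideanSpace ℝ (Fin N)} {k : ℝ → ℝ} {gs : ℕ → EuclideanSpace ℝ (Fin N) → ℝ}
  {g : EuclideanSpace ℝ (Fin N) → ℝ}

/-- Averages of a bounded, weakly convergent sequence converge strongly. -/
lemma tendsto_integral_abs_ballIntegral_rpow (hΩ : IsOpen Ω) (hΩb : Bornology.IsBounded Ω)
    (hpq : p.HolderConjugate q)
    (hgs : ∀ j, MemLp (gs j) (ENNReal.ofReal q) (volume.restrict Ω))
    (hg : MemLp g (ENNReal.ofReal q) (volume.restrict Ω))
    {M : ℝ} (hM : ∀ j, ∫ x, |Ω.indicator (gs j - g) x| ^ q ≤ M)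
    (hweak : WeaklyConverges Ω p gs g) :
    Tendsto (fun j => ∫ y in Ω, |ballIntegral ρ (Ω.indicator (gs j - g)) y| ^ q) atTop
      (𝓝 0) := by
  have : IsFiniteMeasure ((volume : Measure (EuclideanSpace ℝ (Fin N))).restrict Ω) :=
    isFiniteMeasure_restrict.2 hΩb.measure_lt_top.ne
  have hq : 1 < q := hpq.symm.lt
  have hΩm := hΩ.measurableSet
  have h1q : (1 : ENNReal) ≤ ENNReal.ofReal q := by
    rw [← ENNReal.ofReal_one]; exact ENNReal.ofReal_le_ofReal hq.le
  have hGi : ∀ j, Integrable (Ω.indicator (gs j - g)) := fun j =>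
    (integrable_indicator_iff hΩm).2 (((hgs j).sub hg).integrable h1q)
  obtain ⟨C, -, hC⟩ := exists_mul_le_rpow hpq.symm one_pos
  -- Young's inequality against the constant `1` on the bounded set `Ω` gives a uniform `L^1` bound.
  -- It supplies the constant majorant for dominated convergence.
  have hK : ∀ j, ∫ x, |Ω.indicator (gs j - g) x| ≤ M + C * volume.real Ω := fun j => by
    have hmem : MemLp (Ω.indicator (gs j - g)) (ENNReal.ofReal q) volume :=
      (memLp_indicator_iff_restrict hΩm).2 ((hgs j).sub hg)
    have hci : Integrable (Ω.indicator fun _ => C)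
        (volume : Measure (EuclideanSpace ℝ (Fin N))) :=
      (integrable_indicator_iff hΩm).2 (integrableOn_const hΩb.measure_lt_top.ne)
    calc ∫ x, |Ω.indicator (gs j - g) x|
        ≤ ∫ x, (|Ω.indicator (gs j - g) x| ^ q + Ω.indicator (fun _ => C) x) := by
          refine integral_mono (hGi j).abs ((integrable_abs_rpow hq hmem).add hci) fun x => ?_
          by_cases hx : x ∈ Ω
          · have := hC (Ω.indicator (gs j - g) x) 1
            simpa [hx] using this
          · simp [hx, Real.zero_rpow (by linarith : q ≠ 0)]
      _ = (∫ x, |Ω.indicator (gs j - g) x| ^ q) + C * volume.real Ω := by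
          rw [integral_add (integrable_abs_rpow hq hmem) hci, integral_indicator hΩm,
            setIntegral_const, smul_eq_mul, mul_comm C]
      _ ≤ _ := by gcongr; exact hM j
  -- Pointwise convergence is the weak convergence tested against the indicator of a ball.
  have hpt : ∀ y, Tendsto (fun j => ballIntegral ρ (Ω.indicator (gs j - g)) y) atTop (𝓝 0) :=
    fun y => by
    have hβm : AEStronglyMeasurable (fun x => ballIndicator N ρ (y - x)) (volume.restrict Ω) :=
      (measurable_ballIndicator.comp (measurable_const.sub measurable_id)).aestronglyMeasurable
    have hφ : MemLp (fun x => ballIndicator N ρ (y - x)) (ENNReal.ofReal p)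
        (volume.restrict Ω) :=
      MemLp.of_bound hβm 1 (ae_of_all _ fun x => norm_ballIndicator_le_one _)
    have hlim := (hweak _ hφ).sub_const (∫ x in Ω, g x * ballIndicator N ρ (y - x))
    rw [sub_self] at hlim
    refine hlim.congr fun j => ?_
    rw [← integral_sub (integrable_mul_of_memLp hpq (hgs j) hφ) (integrable_mul_of_memLp hpq hg hφ),
      ballIntegral, ← integral_indicator hΩm]
    congr 1
    ext x
    by_cases hx : x ∈ Ω
    · simp [hx, sub_mul]
    · simp [hx]
  have hlim := tendsto_integral_of_dominated_convergence (μ := volume.restrict Ω)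
    (F := fun j y => |ballIntegral ρ (Ω.indicator (gs j - g)) y| ^ q) (f := fun _ => 0)
    (fun _ => (M + C * volume.real Ω) ^ q)
    (fun j => (integrableOn_abs_ballIntegral_rpow hq hΩb (hGi j)).aestronglyMeasurable)
    (integrable_const _)
    (fun j => ae_of_all _ fun y => by
      rw [Real.norm_of_nonneg (by positivity)]
      have := (abs_ballIntegral_le (ρ := ρ) (hGi j) y).trans (hK j)
      gcongr)
    (ae_of_all _ fun y => by
      have := ((hpt y).abs).rpow_const (p := q) (Or.inr (by linarith))
      simpa [Real.zero_rpow (by linarith : q ≠ 0)] using this)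
  simpa using hlim

lemma memLp_extension (hΩ : IsOpen Ω) {w W : EuclideanSpace ℝ (Fin N) → ℝ}
    (hw : w ∈ X Ω p δ k) (hW0 : ∀ x, x ∉ Ω → W x = 0)
    (hWw : W =ᵐ[volume.restrict (extendedDomain Ω δ)] w) :
    MemLp W (ENNReal.ofReal p) volume := by
  have h1 : MemLp W (ENNReal.ofReal p) (volume.restrict (extendedDomain Ω δ)) :=
    (memLp_congr_ae hWw).2 hw.1
  rw [← memLp_indicator_iff_restrict (isOpen_extendedDomain hΩ).measurableSet] at h1
  rwa [indicator_eq_self.2] at h1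
  intro x hx
  by_contra hc
  exact hx (hW0 x fun h => hc (subset_extendedDomain h))

/-- Weak convergence of bounded sources is uniform on bounded subsets of `X₀`. -/
lemma eventually_abs_integral_sub_mul_le (hΩ : IsOpen Ω) (hΩb : Bornology.IsBounded Ω)
    (hpq : p.HolderConjugate q) (hs : 0 < s) (hc₀ : 0 < c₀) (hδ : 0 < δ) (he : ‖e‖ = 1)
    (hk : IsHorizonKernel p s c₀ δ e k)
    (hgs : ∀ j, MemLp (gs j) (ENNReal.ofReal q) (volume.restrict Ω))
    (hg : MemLp g (ENNReal.ofReal q) (volume.restrict Ω))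
    (hbdd : ∃ C : ℝ, ∀ j, ∫ x in Ω, |gs j x| ^ q < C)
    (hweak : WeaklyConverges Ω p gs g) {η : ℝ} (hη : 0 < η) :
    ∀ᶠ j in atTop, ∀ w ∈ X₀ Ω p δ k,
      |∫ x in Ω, (gs j x - g x) * w x| ≤ η * (1 + B Ω p δ k w w) := by
  have hp : 1 < p := hpq.lt
  have hq : 1 < q := hpq.symm.lt
  have hΩm := hΩ.measurableSet
  have hmem : ∀ j, MemLp (Ω.indicator (gs j - g)) (ENNReal.ofReal q) volume := fun j =>
    (memLp_indicator_iff_restrict hΩm).2 ((hgs j).sub hg)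
  obtain ⟨M, hM0, hM⟩ : ∃ M : ℝ, 0 ≤ M ∧ ∀ j, ∫ x, |Ω.indicator (gs j - g) x| ^ q ≤ M := by
    obtain ⟨C, hC⟩ := hbdd
    have hle : ∀ j, ∫ x, |Ω.indicator (gs j - g) x| ^ q ≤
        2 ^ q * (C + ∫ x in Ω, |g x| ^ q) := fun j => by
      have h1 := integrable_abs_rpow hq (hgs j)
      have h2 := integrable_abs_rpow hq hg
      have h3 : (fun x => |Ω.indicator (gs j - g) x| ^ q) =
          Ω.indicator fun x => |gs j x - g x| ^ q := by
        ext x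
        by_cases hx : x ∈ Ω
        · simp [hx]
        · simp [hx, Real.zero_rpow (by linarith : q ≠ 0)]
      rw [h3, integral_indicator hΩm]
      calc ∫ x in Ω, |gs j x - g x| ^ q
          ≤ ∫ x in Ω, 2 ^ q * (|gs j x| ^ q + |g x| ^ q) :=
            integral_mono (integrable_abs_rpow hq ((hgs j).sub hg))
              ((h1.add h2).const_mul _) fun x => abs_sub_rpow_le hq _ _
        _ = 2 ^ q * ((∫ x in Ω, |gs j x| ^ q) + ∫ x in Ω, |g x| ^ q) := by
            rw [integral_const_mul, integral_add h1 h2]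
        _ ≤ _ := by gcongr; exact (hC j).le
    exact ⟨_, le_trans (integral_nonneg fun x => by positivity) (hle 0), hle⟩
  obtain ⟨P, hP0, hP⟩ := exists_poincare hΩ hΩb hp hs hc₀ hδ he hk
  have : Nonempty (Fin N) := by
    by_contra hne
    have : IsEmpty (Fin N) := not_nonempty_iff.1 hne
    have : e = 0 := Subsingleton.elim _ _
    simp [this] at he
  -- The order of choices matters: `τ` makes the source term small and fixes `C`; then `ρ` beats `C`
  -- through `ρ^(sp)`; then `τ'` makes the Poincaré term small and fixes `C'`; last, `j` makes the
  -- averages small. None of these depends on `w`.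
  have hτ : 0 < η / (4 * (M + 1)) := by positivity
  obtain ⟨C, hC0, hC⟩ := exists_mul_le_rpow hpq.symm hτ
  set v₁ := volume.real (ball (0 : EuclideanSpace ℝ (Fin N)) 1) with hv₁
  have hv₁pos : 0 < v₁ := ENNReal.toReal_pos (measure_ball_pos _ _ one_pos).ne'
    measure_ball_lt_top.ne
  obtain ⟨ρ, hρ0, hρδ, hρ⟩ : ∃ ρ : ℝ, 0 < ρ ∧ ρ ≤ δ ∧ C * ρ ^ (s * p) / (c₀ * v₁) ≤ η / 4 := by
    have hlim : Tendsto (fun ρ : ℝ => C * ρ ^ (s * p) / (c₀ * v₁)) (𝓝[>] 0) (𝓝 0) := by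
      have h0 : Tendsto (fun ρ : ℝ => C * ρ ^ (s * p) / (c₀ * v₁)) (𝓝 0)
          (𝓝 (C * 0 ^ (s * p) / (c₀ * v₁))) :=
        ((tendsto_id.rpow_const (Or.inr (by positivity))).const_mul C).div_const _
      rw [Real.zero_rpow (by positivity), mul_zero, zero_div] at h0
      exact h0.mono_left nhdsWithin_le_nhds
    have h1 := hlim.eventually (ge_mem_nhds (by positivity : (0 : ℝ) < η / 4))
    have h2 : ∀ᶠ ρ in 𝓝[>] (0 : ℝ), ρ ∈ Ioc 0 δ := Ioc_mem_nhdsGT hδ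
    obtain ⟨ρ, h1, h2⟩ := (h1.and h2).exists
    exact ⟨ρ, h2.1, h2.2, h1⟩
  set V := volume.real (ball (0 : EuclideanSpace ℝ (Fin N)) ρ) with hV
  have hVeq : V = ρ ^ (N : ℝ) * v₁ := by
    rw [hV, measureReal_def, Measure.addHaar_ball_of_pos _ _ hρ0, finrank_euclideanSpace_fin,
      ENNReal.toReal_mul, ENNReal.toReal_ofReal (by positivity), Real.rpow_natCast, hv₁,
      measureReal_def]
  have hVpos : 0 < V := by rw [hVeq]; positivity
  -- The estimate carries the factor `V` on its left, so every term is measured in units of `V`;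
  -- each of the four will cost one quarter of `η`.
  have hτ' : 0 < V * η / (4 * (P + 1)) := by positivity
  obtain ⟨C', hC0', hC'⟩ := exists_mul_le_rpow hpq hτ'
  have hlim := (tendsto_integral_abs_ballIntegral_rpow (ρ := ρ) hΩ hΩb hpq hgs hg hM
    hweak).const_mul C'
  rw [mul_zero] at hlim
  filter_upwards [hlim.eventually (ge_mem_nhds (by positivity : (0 : ℝ) < V * (η / 4)))]
    with j hj w hw
  obtain ⟨W, hWm, hW0, hWw⟩ := exists_measurable_extension hΩ hw
  have hWp := memLp_extension hΩ hw.1 hW0 hWw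
  have hBnn : 0 ≤ B Ω p δ k w w := B_self_nonneg hp hk
  have hWP : ∫ x, |W x| ^ p ≤ P * B Ω p δ k w w := by
    rw [integral_eq_lintegral_of_nonneg_ae (ae_of_all _ fun x => by positivity)
      (integrable_abs_rpow hp hWp).aestronglyMeasurable]
    refine ENNReal.toReal_le_of_le_ofReal (by positivity) (le_trans (le_of_eq ?_)
      (hP w hw.1 W hWm hW0 hWw))
    refine lintegral_congr fun x => ?_
    rw [← ENNReal.ofReal_rpow_of_nonneg (abs_nonneg _) (by linarith), ← Real.norm_eq_abs,
      ofReal_norm]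
  have key := abs_integral_mul_le hΩ hΩb hpq hs hc₀ hk hw.1 hWm hW0 hWw hWp (hmem j)
    (fun x hx => indicator_of_notMem hx _) hρ0 hρδ hC0 hτ'.le hC hC'
  have heq : ∫ x in Ω, (gs j x - g x) * w x = ∫ x, Ω.indicator (gs j - g) x * W x := by
    rw [← integral_indicator hΩm]
    have hWΩ := (ae_restrict_iff' hΩm).1
      (ae_mono (Measure.restrict_mono_set _ subset_extendedDomain) hWw)
    refine integral_congr_ae ?_
    filter_upwards [hWΩ] with x hx
    by_cases hxΩ : x ∈ Ω
    · simp [hxΩ, hx hxΩ]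
    · simp [hxΩ]
  rw [heq]
  have t1 : η / (4 * (M + 1)) * (V * ∫ x, |Ω.indicator (gs j - g) x| ^ q) ≤ V * (η / 4) := by
    calc _ ≤ η / (4 * (M + 1)) * (V * (M + 1)) := by gcongr; linarith [hM j]
      _ = _ := by field_simp
  have t2 : C * (ρ ^ ((N : ℝ) + s * p) / c₀ * B Ω p δ k w w) ≤
      V * (η / 4 * B Ω p δ k w w) := by
    calc _ = V * (C * ρ ^ (s * p) / (c₀ * v₁) * B Ω p δ k w w) := by
          rw [hVeq, Real.rpow_add hρ0]; field_simp
      _ ≤ _ := by gcongr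
  have t3 : V * η / (4 * (P + 1)) * ∫ x, |W x| ^ p ≤ V * (η / 4 * B Ω p δ k w w) := by
    calc _ ≤ V * η / (4 * (P + 1)) * ((P + 1) * B Ω p δ k w w) := by gcongr; linarith
      _ = _ := by field_simp
  refine le_of_mul_le_mul_left ?_ hVpos
  have t5 : 0 ≤ V * (η * (1 + B Ω p δ k w w)) := by positivity
  calc _ ≤ _ := key
    _ ≤ V * (η / 4) + V * (η / 4 * B Ω p δ k w w) + V * (η / 4 * B Ω p δ k w w) +
        V * (η / 4) := by gcongr
    _ ≤ V * (η * (1 + B Ω p δ k w w)) := by linarith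

end WeakConvergence

/-! ### Stability of states under weak convergence of sources -/

section Stability

variable {N : ℕ} {Ω : Set (EuclideanSpace ℝ (Fin N))} {p q s c₀ δ hmin hmax : ℝ}
  {e : EuclideanSpace ℝ (Fin N)} {k : ℝ → ℝ} {h u₀ g u : EuclideanSpace ℝ (Fin N) → ℝ}
  {gs us : ℕ → EuclideanSpace ℝ (Fin N) → ℝ}

lemma IsState.Bh_sub_Bh (hpq : p.HolderConjugate q) {u₁ u₂ g₁ g₂ w : EuclideanSpace ℝ (Fin N) → ℝ}
    (hg₁ : MemLp g₁ (ENNReal.ofReal q) (volume.restrict Ω))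
    (hg₂ : MemLp g₂ (ENNReal.ofReal q) (volume.restrict Ω))
    (hu₁ : IsState Ω p δ k h u₀ g₁ u₁) (hu₂ : IsState Ω p δ k h u₀ g₂ u₂)
    (hw : w ∈ X₀ Ω p δ k) :
    Bh Ω p δ k h u₁ w - Bh Ω p δ k h u₂ w = ∫ x in Ω, (g₁ x - g₂ x) * w x := by
  have hwΩ : MemLp w (ENNReal.ofReal p) (volume.restrict Ω) :=
    hw.1.1.mono_measure (Measure.restrict_mono_set _ subset_extendedDomain)
  rw [hu₁.equation w hw, hu₂.equation w hw,
    ← integral_sub (integrable_mul_of_memLp hpq hg₁ hwΩ) (integrable_mul_of_memLp hpq hg₂ hwΩ)]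
  simp only [sub_mul]

lemma exists_normX_le (hΩ : IsOpen Ω) (hΩb : Bornology.IsBounded Ω) (hp : 1 < p) (hs : 0 < s)
    (hc₀ : 0 < c₀) (hδ : 0 < δ) (he : ‖e‖ = 1) (hk : IsHorizonKernel p s c₀ δ e k) :
    ∃ C : ℝ, 0 ≤ C ∧ ∀ w ∈ X₀ Ω p δ k,
      normX Ω p δ k w ≤ (C * B Ω p δ k w w) ^ (1 / p) + B Ω p δ k w w ^ (1 / p) := by
  obtain ⟨C, hC0, hC⟩ := exists_poincare hΩ hΩb hp hs hc₀ hδ he hk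
  refine ⟨C, hC0, fun w hw => ?_⟩
  obtain ⟨W, hWm, hW0, hWw⟩ := exists_measurable_extension hΩ hw
  have hp0 : 0 < p := by linarith
  have hB := B_self_nonneg (Ω := Ω) (u := w) hp hk
  rw [normX]
  gcongr
  refine ENNReal.toReal_le_of_le_ofReal (by positivity) ?_
  calc eLpNorm w (ENNReal.ofReal p) (volume.restrict (extendedDomain Ω δ))
      = eLpNorm W (ENNReal.ofReal p) (volume.restrict (extendedDomain Ω δ)) :=
        (eLpNorm_congr_ae hWw).symm
    _ ≤ eLpNorm W (ENNReal.ofReal p) volume := eLpNorm_mono_measure _ Measure.restrict_le_self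
    _ = (∫⁻ x, ‖W x‖ₑ ^ p) ^ (1 / p) := by
        rw [eLpNorm_eq_lintegral_rpow_enorm_toReal (by simpa using hp0) ENNReal.ofReal_ne_top,
          ENNReal.toReal_ofReal hp0.le]
    _ ≤ ENNReal.ofReal (C * B Ω p δ k w w) ^ (1 / p) := by
        gcongr; exact hC w hw.1 W hWm hW0 hWw
    _ = _ := ENNReal.ofReal_rpow_of_nonneg (by positivity) (by positivity)

/-- With `D = B_h(w,w)`, `w = u_j - u`, and `F` the gap of the energies, monotonicity, uniform weak
convergence and coercivity combine to `D + F ≤ κ/2 + D/2`. Absorbing `D/2` bounds both quantities.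
-/
lemma eventually_energy_le (hΩ : IsOpen Ω) (hΩb : Bornology.IsBounded Ω)
    (hpq : p.HolderConjugate q) (hs : 0 < s) (hc₀ : 0 < c₀) (hδ : 0 < δ)
    (hmin_pos : 0 < hmin) (hmin_lt : hmin < hmax) (he : ‖e‖ = 1)
    (hk : IsHorizonKernel p s c₀ δ e k) (hh : IsDiffusionCoefficient Ω δ hmin hmax h)
    (hgs : ∀ j, MemLp (gs j) (ENNReal.ofReal q) (volume.restrict Ω))
    (hg : MemLp g (ENNReal.ofReal q) (volume.restrict Ω))
    (hbdd : ∃ C : ℝ, ∀ j, ∫ x in Ω, |gs j x| ^ q < C)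
    (hweak : WeaklyConverges Ω p gs g)
    (hus : ∀ j, IsState Ω p δ k h u₀ (gs j) (us j)) (hu : IsState Ω p δ k h u₀ g u)
    {κ : ℝ} (hκ : 0 < κ) :
    ∀ᶠ j in atTop, Bh Ω p δ k h (us j - u) (us j - u) ≤ κ ∧
      |Bh Ω p δ k h (us j) (us j) - Bh Ω p δ k h u u| ≤ κ := by
  have hp : 1 < p := hpq.lt
  set E := Bh Ω p δ k h u u with hE
  have hε : 0 < κ / (4 * (|E| + 1)) := by positivity
  obtain ⟨C, hC0, hC⟩ := exists_Bh_sub_le hΩ hp hmin_pos hmin_lt hk hh hε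
  -- The first entry makes `C * η ≤ κ/4`; the second gives `C * η ≤ hmin/4`, so that the energy term
  -- is at most `D/2` after `B ≤ (2/hmin) D`. Using `C + 1` avoids division by zero.
  set η := min (κ / (4 * (C + 1))) (hmin / (4 * (C + 1))) with hη
  have hη0 : 0 < η := lt_min (by positivity) (by positivity)
  have hCη : ∀ r, 0 < r → η ≤ r / (4 * (C + 1)) → C * η ≤ r / 4 := fun r hr hle => by
    calc C * η ≤ (C + 1) * (r / (4 * (C + 1))) := by gcongr; linarith
      _ = r / 4 := by field_simp
  have hη1 := hCη κ hκ (min_le_left _ _)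
  have hη2 := hCη hmin hmin_pos (min_le_right _ _)
  filter_upwards [eventually_abs_integral_sub_mul_le hΩ hΩb hpq hs hc₀ hδ he hk hgs hg hbdd
    hweak hη0] with j hj
  have hw := sub_mem_X₀ hp hk (hus j).mem_X hu.mem_X (hus j).boundary hu.boundary
  have h1 := hC u hu.mem_X (us j) (hus j).mem_X
  rw [(hus j).Bh_sub_Bh hpq (hgs j) hg hu hw, ← hE] at h1
  have h2 := (le_abs_self _).trans (hj _ hw)
  have h3 := B_le_Bh_of_mem_X₀ hΩ hp hmin_pos hmin_lt hk hh hw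
  have hBnn := B_self_nonneg (Ω := Ω) (u := us j - u) hp hk
  set D := Bh Ω p δ k h (us j - u) (us j - u)
  set b := B Ω p δ k (us j - u) (us j - u)
  have hD0 : 0 ≤ D := by
    by_contra! hneg
    have : 2 / hmin * D < 0 := mul_neg_of_pos_of_neg (by positivity) hneg
    linarith
  have h4 : κ / (4 * (|E| + 1)) * E ≤ κ / 4 := by
    calc κ / (4 * (|E| + 1)) * E ≤ κ / (4 * (|E| + 1)) * (|E| + 1) := by
          gcongr; linarith [le_abs_self E]
      _ = κ / 4 := by field_simp
  have h5 : C * (η * (1 + b)) ≤ κ / 4 + D / 2 := by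
    calc C * (η * (1 + b)) = C * η + C * η * b := by ring
      _ ≤ κ / 4 + hmin / 4 * (2 / hmin * D) := by gcongr
      _ = κ / 4 + D / 2 := by field_simp; ring
  have h6 := mul_le_mul_of_nonneg_left h2 hC0
  have h7 := abs_nonneg (Bh Ω p δ k h (us j) (us j) - E)
  constructor <;> linarith

end Stability

end NonlocalPLaplace

/-! ### The convergence theorem -/

theorem mainTheorem7 {N : ℕ} (Ω : Set (EuclideanSpace ℝ (Fin N)))
    (hΩ_open : IsOpen Ω) (hΩ_bdd : Bornology.IsBounded Ω)
    (p s c₀ δ hmin hmax : ℝ) (hp : 1 < p) (hs : s ∈ Ioo (0 : ℝ) 1) (hps : p * s < (N : ℝ))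
    (hc₀ : 0 < c₀) (hδ : 0 < δ) (hmin_pos : 0 < hmin) (hmin_lt : hmin < hmax)
    (e : EuclideanSpace ℝ (Fin N)) (he : ‖e‖ = 1)
    (k : ℝ → ℝ) (hk : NonlocalPLaplace.IsHorizonKernel p s c₀ δ e k)
    (h : EuclideanSpace ℝ (Fin N) → ℝ)
    (hh : NonlocalPLaplace.IsDiffusionCoefficient Ω δ hmin hmax h)
    (u₀ : EuclideanSpace ℝ (Fin N) → ℝ) (hu₀ : NonlocalPLaplace.IsBoundaryDatum Ω p δ k u₀)
    (gs : ℕ → EuclideanSpace ℝ (Fin N) → ℝ) (g : EuclideanSpace ℝ (Fin N) → ℝ)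
    (hgs : ∀ j, MemLp (gs j) (ENNReal.ofReal (p / (p - 1))) (volume.restrict Ω))
    (hg : MemLp g (ENNReal.ofReal (p / (p - 1))) (volume.restrict Ω))
    (hgs_bdd : ∃ C : ℝ, ∀ j, ∫ x in Ω, |gs j x| ^ (p / (p - 1)) < C)
    (hgs_weak : NonlocalPLaplace.WeaklyConverges Ω p gs g)
    (us : ℕ → EuclideanSpace ℝ (Fin N) → ℝ) (u : EuclideanSpace ℝ (Fin N) → ℝ)
    (hus : ∀ j, NonlocalPLaplace.IsState Ω p δ k h u₀ (gs j) (us j))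
    (hu : NonlocalPLaplace.IsState Ω p δ k h u₀ g u) :
    Tendsto (fun j => NonlocalPLaplace.Bh Ω p δ k h (us j) (us j)) atTop
        (𝓝 (NonlocalPLaplace.Bh Ω p δ k h u u)) ∧
      Tendsto (fun j => NonlocalPLaplace.Bh Ω p δ k h (us j - u) (us j - u)) atTop (𝓝 0) ∧
      Tendsto (fun j => NonlocalPLaplace.normX Ω p δ k (us j - u)) atTop (𝓝 0) := by
  open NonlocalPLaplace in
  have hpq : p.HolderConjugate (p / (p - 1)) := Real.HolderConjugate.conjExponent hp
  have hev : ∀ κ : ℝ, 0 < κ → _ := fun κ hκ =>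
    eventually_energy_le hΩ_open hΩ_bdd hpq hs.1 hc₀ hδ hmin_pos hmin_lt he hk hh hgs hg hgs_bdd
      hgs_weak hus hu (κ := κ) hκ
  have hw : ∀ j, us j - u ∈ X₀ Ω p δ k := fun j =>
    sub_mem_X₀ hp hk (hus j).mem_X hu.mem_X (hus j).boundary hu.boundary
  have hB0 : ∀ j, 0 ≤ B Ω p δ k (us j - u) (us j - u) := fun j => B_self_nonneg hp hk
  have hle : ∀ j, B Ω p δ k (us j - u) (us j - u) ≤
      2 / hmin * Bh Ω p δ k h (us j - u) (us j - u) := fun j =>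
    B_le_Bh_of_mem_X₀ hΩ_open hp hmin_pos hmin_lt hk hh (hw j)
  have hD0 : ∀ j, 0 ≤ Bh Ω p δ k h (us j - u) (us j - u) := fun j =>
    nonneg_of_mul_nonneg_right ((hB0 j).trans (hle j)) (by positivity)
  have hD : Tendsto (fun j => Bh Ω p δ k h (us j - u) (us j - u)) atTop (𝓝 0) := by
    rw [Metric.tendsto_nhds]
    intro κ hκ
    filter_upwards [hev (κ / 2) (by positivity)] with j hj
    rw [Real.dist_eq, sub_zero, abs_of_nonneg (hD0 j)]
    linarith [hj.1]
  refine ⟨?_, hD, ?_⟩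
  · rw [Metric.tendsto_nhds]
    intro κ hκ
    filter_upwards [hev (κ / 2) (by positivity)] with j hj
    rw [Real.dist_eq]
    linarith [hj.2]
  -- Coercivity on `X₀` passes from `B_h` to `B`, and Poincaré then bounds the full norm by powers
  -- of `B`.
  · have hB : Tendsto (fun j => B Ω p δ k (us j - u) (us j - u)) atTop (𝓝 0) := by
      refine squeeze_zero hB0 hle ?_
      simpa using hD.const_mul (2 / hmin)
    obtain ⟨C, hC0, hC⟩ := exists_normX_le hΩ_open hΩ_bdd hp hs.1 hc₀ hδ he hk
    have hp' : 0 < 1 / p := by positivity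
    have hpow : ∀ f : ℕ → ℝ, Tendsto f atTop (𝓝 0) →
        Tendsto (fun j => f j ^ (1 / p)) atTop (𝓝 0) := fun f hf => by
      have := hf.rpow_const (p := 1 / p) (Or.inr hp'.le)
      rwa [Real.zero_rpow hp'.ne'] at this
    refine squeeze_zero (fun j => ?_) (fun j => hC _ (hw j)) ?_
    · exact add_nonneg ENNReal.toReal_nonneg (Real.rpow_nonneg (hB0 j) _)
    · have h1 := hB.const_mul C
      rw [mul_zero] at h1
      simpa using (hpow _ h1).add (hpow _ hB)
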